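/- **Theorem 4.** *Setting.* For $l=1,2$ let $X_l\subset\mathbb R^{m_l}$ be nonempty, compact and convex, let $\|\cdot\|$ be a norm on $\mathbb R^{m_l}$ with dual norm $\|\cdot\|_*$, and let network $\Sigma_l$ have $n_l$ agents, $\mathcal V_l=\{1,\dots,n_l\}$. Agent $i$ of $\Sigma_l$ has the cost $f_{l,i}(x_1,x_2)=\mathbb E[F_{l,i}(x_1,x_2;\xi)]$ on $X_1\times X_2$, where $\xi$ is an $\mathbb R^d$-valued random vector, and $$U(x_1,x_2)=\frac1{n_1}\sum_{i=1}^{n_1}f_{1,i}(x_1,x_2)=-\frac1{n_2}\sum_{j=1}^{n_2}f_{2,j}(x_1,x_2).$$ *Networks.* Fix $0<\eta<1$. At time $t\ge0$ the agents of $\Sigma_l$ communicate along a digraph $(\mathcal V_l,\mathcal E_l(t))$ that contains all self-loops $(i,i)$, with a doubly stochastic matrix $W_l(t)=[w_{l,ij}(t)]$ such that $w_{l,ij}(t)\ge\eta$ if $(j,i)\in\mathcal E_l(t)$ and $w_{l,ij}(t)=0$ otherwise; there is an integer $B_l\ge1$ such that the union of the graphs of any $B_l$ consecutive times is strongly connected.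 Between the networks, agent $i\in\mathcal V_l$ uses nonnegative weights $w_{12,ij}(t)$, $j\in\mathcal V_{3-l}$, with $\sum_j w_{12,ij}(t)=1$, which are positive only along the edges of a bipartite digraph. Put $\Gamma_l=(1-\eta/4n_l^2)^{-2}$ and $\theta_l=(1-\eta/4n_l^2)^{1/B_l}$. *Algorithm (D-SMD).* Let $\psi_l$ be a differentiable function on $X_l$, $1$-strongly convex with respect to $\|\cdot\|$, with Bregman divergence $D_{\psi_l}(x,p)=\psi_l(x)-\psi_l(p)-\langle\nabla\psi_l(p),x-p\rangle$ bounded on $X_l\times X_l$, put $R_l^2=\sup\{D_{\psi_l}(x,x'):x,x'\in X_l\}$, and let $P^l_p(y)=\arg\min_{x'\in X_l}\{\langle y,p-x'\rangle+D_{\psi_l}(x',p)\}$. Let $\alpha(0)\ge\alpha(1)\ge\dots\ge0$ with $\alpha(0)>0$, and let $x_{l,i}(0)\in X_l$ be (possibly random) initial states. For $t\ge0$ put $v_{l,i}(t)=\sum_{j}w_{l,ij}(t)x_{l,j}(t)$ and $u_{3-l,i}(t)=\sum_{j}w_{12,ij}(t)x_{3-l,j}(t)$ for $i\in\mathcal V_l$;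 agent $i\in\mathcal V_l$ receives a sampled subgradient $\hat g_{l,i}(t)$, that is, a subgradient with respect to $x_l\in X_l$ of $F_{l,i}(\cdot\,;\xi_{l,i}(t))$ at $x_l=v_{l,i}(t)$, with $x_{3-l}=u_{3-l,i}(t)$ fixed, and sets $x_{l,i}(t+1)=P^l_{v_{l,i}(t)}(-\alpha(t)\hat g_{l,i}(t))$. The samples $\xi_{l,i}(t)$ are independent copies of $\xi$. Let $\mathcal F_t$ be the $\sigma$-algebra generated by all $x_{l,i}(0)$ and all $\xi_{l,i}(s)$, $s<t$; $\hat g_{l,i}(t)$ is $\mathcal F_{t+1}$-measurable. Let $\Lambda_l=\mathbb E\left[\max_{i\in\mathcal V_l}\|x_{l,i}(0)\|\right]$ (so $\Lambda_l=\max_i\|x_{l,i}(0)\|$ for deterministic initial states). *Assumptions.* Every $f_{1,i}$ is convex in $x_1$ and concave in $x_2$, every $f_{2,j}$ is concave in $x_1$ and convex in $x_2$, and: (A1) there is $L>0$ with $|f_{l,i}(x_1,x_2)-f_{l,i}(x_1',x_2')|\le L(\|x_1-x_1'\|+\|x_2-x_2'\|)$ on $X_1\times X_2$, for all $l,i$;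 (A2) there are $\nu_1,\nu_2>0$ such that, for all $l,i,t$, $\hat g_{l,i}(t)$ is integrable, $\mathbb E[\hat g_{l,i}(t)\mid\mathcal F_t]=g_{l,i}(t)$ and $\mathbb E[\|g_{l,i}(t)-\hat g_{l,i}(t)\|_*^2\mid\mathcal F_t]\le\nu_l^2$, where $g_{l,i}(t)$ is a subgradient with respect to $x_l\in X_l$ of $f_{l,i}$ at $x_l=v_{l,i}(t)$, with $x_{3-l}=u_{3-l,i}(t)$ fixed, and $\|g_{l,i}(t)\|_*\le L$; (A3) for $l=1,2$, $D_{\psi_l}(x,y)$ is convex in $y$, and $x_k\to x$ implies $D_{\psi_l}(x_k,x)\to0$. *Conclusion.* For all $i\in\mathcal V_1$, $j\in\mathcal V_2$ and $t\ge1$, with $\hat x_{l,i}(t)=\sum_{s=0}^{t-1}\alpha(s)x_{l,i}(s)\big/\sum_{s=0}^{t-1}\alpha(s)$, the gap $$\delta(\hat x_{1,i}(t),\hat x_{2,j}(t))=\max_{x_2\in X_2}U(\hat x_{1,i}(t),x_2)-\min_{x_1\in X_1}U(x_1,\hat x_{2,j}(t))$$ is integrable and $$\mathbb E\left[\delta(\hat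 x_{1,i}(t),\hat x_{2,j}(t))\right]\le\frac{M_1+M_2\sum_{s=0}^{t-1}\alpha^2(s)}{\sum_{s=0}^{t-1}\alpha(s)},$$ where $$M_1=\sum_{l=1}^2\left(\frac{4Ln_l\Gamma_l\Lambda_l\alpha(0)}{1-\theta_l}+2R_l^2\right),\qquad M_2=\sum_{l=1}^2\left(4L(L+\nu_l)\left(\frac{n_l\Gamma_l}{1-\theta_l}+2\right)+(L+\nu_l)^2+\frac{\nu_l^2}2\right).$$ -/

import Mathlib

open MeasureTheory ProbabilityTheory Set Filter Topology

noncomputable section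

namespace DSMD

section OneSpace

variable {E : Type*} [NormedAddCommGroup E] [NormedSpace ℝ E]

/-- `g` is a subgradient at `v` of the function `h`, regarded as a function on `X`. -/
def IsSubgradientOn (X : Set E) (h : E → ℝ) (v : E) (g : StrongDual ℝ E) : Prop :=
  ∀ y ∈ X, h v + g (y - v) ≤ h y

/-- The Bregman divergence `D_ψ(x, p) = ψ(x) - ψ(p) - ⟨∇ψ(p), x - p⟩` of a regularizer `ψ` on `X`.
For `x, p` in a convex set `X` the last term is the derivative of `ψ` at `p` in the feasible
direction `x - p`, so it does not depend on the choice of the derivative within `X`. -/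
def bregman (X : Set E) (ψ : E → ℝ) (x p : E) : ℝ :=
  ψ x - ψ p - fderivWithin ℝ ψ X p (x - p)

/-- The values of the Bregman divergence on `X × X`. -/
def bregmanValues (X : Set E) (ψ : E → ℝ) : Set ℝ :=
  {r | ∃ x ∈ X, ∃ x' ∈ X, r = bregman X ψ x x'}

/-- The squared Bregman diameter `R² = max {D_ψ(x, x') : x, x' ∈ X}`. -/
def bregmanDiamSq (X : Set E) (ψ : E → ℝ) : ℝ := sSup (bregmanValues X ψ)

/-- `ψ` is a differentiable regularizer on `X`, `1`-strongly convex for the norm of `E`, whose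
Bregman divergence is bounded on `X × X` (this is automatic when `ψ` is continuously
differentiable on a neighbourhood of the compact set `X`). -/
structure IsRegularizer (X : Set E) (ψ : E → ℝ) : Prop where
  strongConvexOn : StrongConvexOn X 1 ψ
  differentiableOn : DifferentiableOn ℝ ψ X
  bddAbove : BddAbove (bregmanValues X ψ)

/-- The Bregman divergence is convex in its second argument, and `x_k → x` implies
`D_ψ(x_k, x) → 0`. -/
structure BregmanAssumption (X : Set E) (ψ : E → ℝ) : Prop where
  convexOn_right : ∀ x ∈ X, ConvexOn ℝ X (fun y => bregman X ψ x y)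
  reciprocity : ∀ (z : ℕ → E) (x : E), (∀ k, z k ∈ X) → x ∈ X → Tendsto z atTop (𝓝 x) →
    Tendsto (fun k => bregman X ψ (z k) x) atTop (𝓝 0)

/-- `q` is the value of the prox-mapping
`P_p(y) = argmin_{x' ∈ X} {⟨y, p - x'⟩ + D_ψ(x', p)}`. -/
def IsProx (X : Set E) (ψ : E → ℝ) (p : E) (y : StrongDual ℝ E) (q : E) : Prop :=
  q ∈ X ∧ ∀ x' ∈ X, y (p - q) + bregman X ψ q p ≤ y (p - x') + bregman X ψ x' p

/-- The weighted average `∑_j w_{ij} x_j` computed by agent `i`. -/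
def mix {m n : ℕ} (w : Matrix (Fin m) (Fin n) ℝ) (x : Fin n → E) (i : Fin m) : E :=
  ∑ j, w i j • x j

/-- The step-size weighted time average of `x(0), …, x(t-1)`. -/
def timeAvg (α : ℕ → ℝ) (x : ℕ → E) (t : ℕ) : E :=
  (∑ s ∈ Finset.range t, α s)⁻¹ • ∑ s ∈ Finset.range t, α s • x s

end OneSpace

section TwoSpaces

variable {E F : Type*} [NormedAddCommGroup E] [NormedSpace ℝ E]
  [NormedAddCommGroup F] [NormedSpace ℝ F]

/-- `h` is convex in its first argument and concave in its second one. -/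
def ConvexConcaveOn (X : Set E) (Y : Set F) (h : E → F → ℝ) : Prop :=
  (∀ y ∈ Y, ConvexOn ℝ X (fun x => h x y)) ∧ (∀ x ∈ X, ConcaveOn ℝ Y (fun y => h x y))

/-- `|h(x, y) - h(x', y')| ≤ L (‖x - x'‖ + ‖y - y'‖)` on `X × Y`. -/
def LipOn (X : Set E) (Y : Set F) (L : ℝ) (h : E → F → ℝ) : Prop :=
  ∀ x ∈ X, ∀ x' ∈ X, ∀ y ∈ Y, ∀ y' ∈ Y, |h x y - h x' y'| ≤ L * (‖x - x'‖ + ‖y - y'‖)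

end TwoSpaces

/-- One network of `n` agents: a sequence of digraphs (`(G t).Adj j i` means that `i` receives
from `j` at time `t`) and of mixing matrices. Every agent uses its own state, the weights are at
least `η` on the edges and vanish elsewhere, the matrices are doubly stochastic, and the union of
any `B` consecutive graphs is strongly connected. -/
structure IsMixing {n : ℕ} (η : ℝ) (B : ℕ) (G : ℕ → Digraph (Fin n))
    (W : ℕ → Matrix (Fin n) (Fin n) ℝ) : Prop where
  self_loop : ∀ t i, (G t).Adj i i
  le_weight : ∀ t i j, (G t).Adj j i → η ≤ W t i j
  weight_eq_zero : ∀ t i j, ¬ (G t).Adj j i → W t i j = 0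
  row_sum : ∀ t i, ∑ j, W t i j = 1
  col_sum : ∀ t j, ∑ i, W t i j = 1
  one_le : 1 ≤ B
  connected : ∀ k i j,
    Relation.ReflTransGen (fun a b => ∃ t, k ≤ t ∧ t < k + B ∧ (G t).Adj a b) i j

/-- The communication structure of the two networks and of the bipartite network between them.
`W₁₂ t i j` is the weight that agent `i` of the first network gives to agent `j` of the second
one, and `W₂₁ t j i` the weight that agent `j` of the second network gives to agent `i` of the
first one. -/
structure Network (n₁ n₂ : ℕ) (η : ℝ) (B₁ B₂ : ℕ) where
  G₁ : ℕ → Digraph (Fin n₁)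
  G₂ : ℕ → Digraph (Fin n₂)
  G₁₂ : ℕ → Digraph (Fin n₁ ⊕ Fin n₂)
  W₁ : ℕ → Matrix (Fin n₁) (Fin n₁) ℝ
  W₂ : ℕ → Matrix (Fin n₂) (Fin n₂) ℝ
  W₁₂ : ℕ → Matrix (Fin n₁) (Fin n₂) ℝ
  W₂₁ : ℕ → Matrix (Fin n₂) (Fin n₁) ℝ
  η_pos : 0 < η
  η_lt_one : η < 1
  mixing₁ : IsMixing η B₁ G₁ W₁
  mixing₂ : IsMixing η B₂ G₂ W₂
  bipartite : ∀ t a b, (G₁₂ t).Adj a b → a.isLeft ≠ b.isLeft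
  nonneg₁₂ : ∀ t i j, 0 ≤ W₁₂ t i j
  nonneg₂₁ : ∀ t j i, 0 ≤ W₂₁ t j i
  edge₁₂ : ∀ t i j, 0 < W₁₂ t i j → (G₁₂ t).Adj (Sum.inr j) (Sum.inl i)
  edge₂₁ : ∀ t j i, 0 < W₂₁ t j i → (G₁₂ t).Adj (Sum.inl i) (Sum.inr j)
  row_sum₁₂ : ∀ t i, ∑ j, W₁₂ t i j = 1
  row_sum₂₁ : ∀ t j, ∑ i, W₂₁ t j i = 1

/-- `Γ = (1 - η / (4 n²))⁻²`. -/
def Gam (η : ℝ) (n : ℕ) : ℝ := ((1 - η / (4 * (n : ℝ) ^ 2)) ^ 2)⁻¹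

/-- `θ = (1 - η / (4 n²))^{1/B}`. -/
def theta (η : ℝ) (n B : ℕ) : ℝ := (1 - η / (4 * (n : ℝ) ^ 2)) ^ (1 / (B : ℝ))

section Game

variable {Ω E₁ E₂ : Type*} [MeasurableSpace Ω]
  [NormedAddCommGroup E₁] [NormedSpace ℝ E₁] [NormedAddCommGroup E₂] [NormedSpace ℝ E₂]

/-- The average `(1/n) ∑_i f_i` of cost functions. -/
def avgCost {n : ℕ} (f : Fin n → E₁ → E₂ → ℝ) (x₁ : E₁) (x₂ : E₂) : ℝ :=
  (1 / (n : ℝ)) * ∑ i, f i x₁ x₂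

/-- The expected cost `f(x₁, x₂) = 𝔼[F(x₁, x₂; ξ)]`. -/
def expCost {d n : ℕ} (P : Measure Ω) (F : Fin n → E₁ → E₂ → (Fin d → ℝ) → ℝ)
    (ξ : Ω → Fin d → ℝ) (i : Fin n) (x₁ : E₁) (x₂ : E₂) : ℝ :=
  ∫ ω, F i x₁ x₂ (ξ ω) ∂P

/-- A two-network stochastic zero-sum game: compact convex strategy sets, sampled costs of the
agents of both networks (only their values on `X₁ × X₂` matter), and the random vector that
they depend on. -/
structure Game (P : Measure Ω) (E₁ E₂ : Type*) [NormedAddCommGroup E₁] [NormedSpace ℝ E₁]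
    [NormedAddCommGroup E₂] [NormedSpace ℝ E₂] (n₁ n₂ d : ℕ) where
  X₁ : Set E₁
  X₂ : Set E₂
  F₁ : Fin n₁ → E₁ → E₂ → (Fin d → ℝ) → ℝ
  F₂ : Fin n₂ → E₁ → E₂ → (Fin d → ℝ) → ℝ
  ξ : Ω → Fin d → ℝ
  nonempty₁ : X₁.Nonempty
  nonempty₂ : X₂.Nonempty
  compact₁ : IsCompact X₁
  compact₂ : IsCompact X₂
  convex₁ : Convex ℝ X₁
  convex₂ : Convex ℝ X₂
  measurable_ξ : Measurable ξ
  integrable₁ : ∀ i, ∀ x₁ ∈ X₁, ∀ x₂ ∈ X₂, Integrable (fun ω => F₁ i x₁ x₂ (ξ ω)) P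
  integrable₂ : ∀ j, ∀ x₁ ∈ X₁, ∀ x₂ ∈ X₂, Integrable (fun ω => F₂ j x₁ x₂ (ξ ω)) P
  zero_sum : ∀ x₁ ∈ X₁, ∀ x₂ ∈ X₂,
    avgCost (expCost P F₁ ξ) x₁ x₂ = -avgCost (expCost P F₂ ξ) x₁ x₂

namespace Game

variable {P : Measure Ω} {n₁ n₂ d : ℕ} (Γ : Game P E₁ E₂ n₁ n₂ d)

/-- The expected cost of agent `i` of the first network. -/
def f₁ (i : Fin n₁) (x₁ : E₁) (x₂ : E₂) : ℝ := expCost P Γ.F₁ Γ.ξ i x₁ x₂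

/-- The expected cost of agent `j` of the second network. -/
def f₂ (j : Fin n₂) (x₁ : E₁) (x₂ : E₂) : ℝ := expCost P Γ.F₂ Γ.ξ j x₁ x₂

/-- The cost function `U = (1/n₁) ∑ f_{1,i} = -(1/n₂) ∑ f_{2,j}` of the game. -/
def U (x₁ : E₁) (x₂ : E₂) : ℝ := avgCost Γ.f₁ x₁ x₂

/-- The gap `max_{x₂ ∈ X₂} U(y₁, x₂) - min_{x₁ ∈ X₁} U(x₁, y₂)`. -/
def gap (y₁ : E₁) (y₂ : E₂) : ℝ :=
  sSup ((fun x₂ => Γ.U y₁ x₂) '' Γ.X₂) - sInf ((fun x₁ => Γ.U x₁ y₂) '' Γ.X₁)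

/-- Every `f_{1,i}` is convex-concave and every `f_{2,j}` is concave-convex. -/
def CostsConvexConcave : Prop :=
  (∀ i, ConvexConcaveOn Γ.X₁ Γ.X₂ (Γ.f₁ i)) ∧
    (∀ j, ConvexConcaveOn Γ.X₂ Γ.X₁ (fun x₂ x₁ => Γ.f₂ j x₁ x₂))

/-- All the costs are Lipschitz continuous on `X₁ × X₂` with constant `L > 0`. -/
def LipschitzAssumption (L : ℝ) : Prop :=
  0 < L ∧ (∀ i, LipOn Γ.X₁ Γ.X₂ L (Γ.f₁ i)) ∧ (∀ j, LipOn Γ.X₁ Γ.X₂ L (Γ.f₂ j))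

end Game

/-- `ℱ_t`, the `σ`-algebra generated by the initial states and by the samples drawn before
time `t`. -/
@[reducible] def history [MeasurableSpace E₁] [MeasurableSpace E₂] {n₁ n₂ d : ℕ} (x₁ : Fin n₁ → Ω → E₁)
    (x₂ : Fin n₂ → Ω → E₂) (ξ : ℕ → Fin n₁ ⊕ Fin n₂ → Ω → Fin d → ℝ) (t : ℕ) :
    MeasurableSpace Ω :=
  (⨆ i, MeasurableSpace.comap (x₁ i) inferInstance) ⊔
    (⨆ j, MeasurableSpace.comap (x₂ j) inferInstance) ⊔
    (⨆ (s : ℕ) (_ : s < t) (k : Fin n₁ ⊕ Fin n₂), MeasurableSpace.comap (ξ s k) inferInstance)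

/-- A run of distributed stochastic mirror descent with step sizes `α` and regularizers
`ψ₁, ψ₂`: states `x`, independent samples `ξ` distributed as the random vector of the game, and
sampled subgradients `g`, chosen as functions of the information available at the time. -/
structure Run {P : Measure Ω} {n₁ n₂ d : ℕ} [MeasurableSpace E₁] [MeasurableSpace E₂]
    (Γ : Game P E₁ E₂ n₁ n₂ d) {η : ℝ} {B₁ B₂ : ℕ} (N : Network n₁ n₂ η B₁ B₂)
    (ψ₁ : E₁ → ℝ) (ψ₂ : E₂ → ℝ) (α : ℕ → ℝ) where
  x₁ : ℕ → Fin n₁ → Ω → E₁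
  x₂ : ℕ → Fin n₂ → Ω → E₂
  ξ : ℕ → Fin n₁ ⊕ Fin n₂ → Ω → Fin d → ℝ
  g₁ : ℕ → Fin n₁ → Ω → StrongDual ℝ E₁
  g₂ : ℕ → Fin n₂ → Ω → StrongDual ℝ E₂
  measurable_init₁ : ∀ i, Measurable (x₁ 0 i)
  measurable_init₂ : ∀ j, Measurable (x₂ 0 j)
  init_mem₁ : ∀ i ω, x₁ 0 i ω ∈ Γ.X₁
  init_mem₂ : ∀ j ω, x₂ 0 j ω ∈ Γ.X₂
  measurable_ξ : ∀ t k, Measurable (ξ t k)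
  indep : iIndepFun (fun p : ℕ × (Fin n₁ ⊕ Fin n₂) => ξ p.1 p.2) P
  identDistrib : ∀ t k, IdentDistrib (ξ t k) Γ.ξ P P
  subgradient₁ : ∀ t i ω, IsSubgradientOn Γ.X₁
    (fun y => Γ.F₁ i y (mix (N.W₁₂ t) (fun j => x₂ t j ω) i) (ξ t (Sum.inl i) ω))
    (mix (N.W₁ t) (fun k => x₁ t k ω) i) (g₁ t i ω)
  subgradient₂ : ∀ t j ω, IsSubgradientOn Γ.X₂
    (fun y => Γ.F₂ j (mix (N.W₂₁ t) (fun i => x₁ t i ω) j) y (ξ t (Sum.inr j) ω))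
    (mix (N.W₂ t) (fun k => x₂ t k ω) j) (g₂ t j ω)
  measurable_g₁ : ∀ t i, StronglyMeasurable[history (x₁ 0) (x₂ 0) ξ (t + 1)] (g₁ t i)
  measurable_g₂ : ∀ t j, StronglyMeasurable[history (x₁ 0) (x₂ 0) ξ (t + 1)] (g₂ t j)
  step₁ : ∀ t i ω, IsProx Γ.X₁ ψ₁ (mix (N.W₁ t) (fun k => x₁ t k ω) i) (-(α t • g₁ t i ω))
    (x₁ (t + 1) i ω)
  step₂ : ∀ t j ω, IsProx Γ.X₂ ψ₂ (mix (N.W₂ t) (fun k => x₂ t k ω) j) (-(α t • g₂ t j ω))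
    (x₂ (t + 1) j ω)

/-- Given the past `ℱ`, the sampled subgradient `ghat` is an unbiased estimate, with conditional
variance at most `ν²`, of a subgradient of `h ω` on `X` at `v ω`. The subgradient is one of those
that an `L`-Lipschitz function has on the whole space, that is, of dual norm at most `L`; for
`v ω` in the interior of `X` this is automatic if `h ω` is `L`-Lipschitz on `X`. -/
def UnbiasedBounded {E : Type*} [NormedAddCommGroup E] [NormedSpace ℝ E] (P : Measure Ω)
    (ℱ : MeasurableSpace Ω) (X : Set E) (h : Ω → E → ℝ) (v : Ω → E)
    (ghat : Ω → StrongDual ℝ E) (L ν : ℝ) : Prop :=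
  ∃ g : Ω → StrongDual ℝ E,
    (∀ᵐ ω ∂P, IsSubgradientOn X (h ω) (v ω) (g ω) ∧ ‖g ω‖ ≤ L) ∧
    Integrable ghat P ∧ P[ghat | ℱ] =ᵐ[P] g ∧
    Integrable (fun ω => ‖g ω - ghat ω‖ ^ 2) P ∧
    P[fun ω => ‖g ω - ghat ω‖ ^ 2 | ℱ] ≤ᵐ[P] fun _ => ν ^ 2

namespace Run

variable {P : Measure Ω} {n₁ n₂ d : ℕ} [MeasurableSpace E₁] [MeasurableSpace E₂]
  {Γ : Game P E₁ E₂ n₁ n₂ d} {η : ℝ} {B₁ B₂ : ℕ} {N : Network n₁ n₂ η B₁ B₂}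
  {ψ₁ : E₁ → ℝ} {ψ₂ : E₂ → ℝ} {α : ℕ → ℝ} (R : Run Γ N ψ₁ ψ₂ α)

/-- The sampled subgradients of all the agents are conditionally unbiased, with conditional
variances at most `ν₁²` and `ν₂²`. -/
def SamplingAssumption (L ν₁ ν₂ : ℝ) : Prop :=
  0 < ν₁ ∧ 0 < ν₂ ∧
  (∀ t i, UnbiasedBounded P (history (R.x₁ 0) (R.x₂ 0) R.ξ t) Γ.X₁
    (fun ω y => Γ.f₁ i y (mix (N.W₁₂ t) (fun j => R.x₂ t j ω) i))
    (fun ω => mix (N.W₁ t) (fun k => R.x₁ t k ω) i) (R.g₁ t i) L ν₁) ∧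
  (∀ t j, UnbiasedBounded P (history (R.x₁ 0) (R.x₂ 0) R.ξ t) Γ.X₂
    (fun ω y => Γ.f₂ j (mix (N.W₂₁ t) (fun i => R.x₁ t i ω) j) y)
    (fun ω => mix (N.W₂ t) (fun k => R.x₂ t k ω) j) (R.g₂ t j) L ν₂)

/-- `Λ₁ = max_i ‖x_{1,i}(0)‖`, in expectation if the initial states are random. -/
def Lam₁ : ℝ := ∫ ω, (⨆ i, ‖R.x₁ 0 i ω‖) ∂P

/-- `Λ₂ = max_j ‖x_{2,j}(0)‖`, in expectation if the initial states are random. -/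
def Lam₂ : ℝ := ∫ ω, (⨆ j, ‖R.x₂ 0 j ω‖) ∂P

end Run

end Game

/-- The contribution `4 L n Γ Λ α(0) / (1 - θ) + 2 R²` of one network to the constant `M₁`. -/
def constM₁ (L η : ℝ) (n B : ℕ) (Λ α₀ Rsq : ℝ) : ℝ :=
  4 * L * n * Gam η n * Λ * α₀ / (1 - theta η n B) + 2 * Rsq

/-- The contribution `4 L (L + ν) (n Γ / (1 - θ) + 2) + (L + ν)² + ν² / 2` of one network to the
constant `M₂`. -/
def constM₂ (L ν η : ℝ) (n B : ℕ) : ℝ :=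
  4 * L * (L + ν) * (n * Gam η n / (1 - theta η n B) + 2) + (L + ν) ^ 2 + ν ^ 2 / 2

end DSMD

end

/-!
Doubly stochastic mixing over strongly connected windows contracts the spread of the states: a gap
between two consecutive order statistics survives until an edge first crosses the corresponding
cut, where a fixed fraction of it is dissipated. Hence the products of the mixing matrices
converge geometrically to the average, and the disagreement of the agents is at most a geometric
convolution of the step sizes.

Each agent's step is a prox step, so the three point inequality bounds the regret of its points
against any fixed `z`, and the Bregman divergences telescope because they are convex in the second
argument and the mixing is doubly stochastic. The gap maximizes over the comparison point, which
therefore depends on the sampling noise. A ghost dual averaging iterate driven by the noise alone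
restores adaptedness: the noise tested against the ghost iterate has mean zero, and the regret of
the ghost iterate costs a further
`R²` in total and `ν² / 2` per step. Finally, convexity and concavity of
`U` with the Lipschitz bounds turn the gap of the time averages into the two regrets plus a multiple
of the disagreements.
-/

noncomputable section

namespace DSMD

section Averaging

open Matrix

variable {ι : Type*}

lemma sum_sq_sub_le_sq_sub {y : ℕ → ℝ} (hy : Monotone y) (A : Finset ℕ) {a b : ℝ}
    (h : ∀ l ∈ A, a ≤ y l ∧ y (l + 1) ≤ b) :
    ∑ l ∈ A, (y (l + 1) - y l) ^ 2 ≤ (b - a) ^ 2 := by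
  rcases A.eq_empty_or_nonempty with rfl | hne
  · simpa using sq_nonneg _
  have hgap (l : ℕ) : 0 ≤ y (l + 1) - y l := sub_nonneg.2 (hy l.le_succ)
  have hsub : A ⊆ Finset.Ico (A.min' hne) (A.max' hne + 1) := fun l hl =>
    Finset.mem_Ico.2 ⟨A.min'_le l hl, Nat.lt_succ_of_le (A.le_max' l hl)⟩
  have hsum : ∑ l ∈ A, (y (l + 1) - y l) ≤ b - a := by
    calc ∑ l ∈ A, (y (l + 1) - y l)
        ≤ ∑ l ∈ Finset.Ico (A.min' hne) (A.max' hne + 1), (y (l + 1) - y l) :=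
          Finset.sum_le_sum_of_subset_of_nonneg hsub fun l _ _ => hgap l
      _ = y (A.max' hne + 1) - y (A.min' hne) :=
          Finset.sum_Ico_sub y ((A.min'_le _ (A.max'_mem hne)).trans (Nat.le_succ _))
      _ ≤ b - a := sub_le_sub (h _ (A.max'_mem hne)).2 (h _ (A.min'_mem hne)).1
  calc ∑ l ∈ A, (y (l + 1) - y l) ^ 2 ≤ (∑ l ∈ A, (y (l + 1) - y l)) ^ 2 :=
        Finset.sum_sq_le_sq_sum_of_nonneg fun l _ => hgap l
    _ ≤ (b - a) ^ 2 := pow_le_pow_left₀ (Finset.sum_nonneg fun l _ => hgap l) hsum 2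

/-- The values of `z` are at most `a` on `S` and at least `b` outside `S`. -/
def Separates (z : ι → ℝ) (S : Set ι) (a b : ℝ) : Prop :=
  (∀ i ∈ S, z i ≤ a) ∧ ∀ i ∉ S, b ≤ z i

lemma sum_gap_sq_mul_indicator_sub_sq_le {y : ℕ → ℝ} (hy : Monotone y) {z : ι → ℝ} {ρ : ι → ℕ}
    {D : Finset ℕ} (hD : ∀ l ∈ D, Separates z {i | ρ i ≤ l} (y l) (y (l + 1))) (i j : ι) :
    ∑ l ∈ D, (y (l + 1) - y l) ^ 2 *
      ({i | ρ i ≤ l}.indicator 1 i - {i | ρ i ≤ l}.indicator 1 j) ^ 2 ≤ (z i - z j) ^ 2 := by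
  wlog hij : ρ i ≤ ρ j generalizing i j
  · simpa only [sub_sq_comm] using this j i (le_of_not_ge hij)
  calc ∑ l ∈ D, (y (l + 1) - y l) ^ 2 *
        ({i | ρ i ≤ l}.indicator 1 i - {i | ρ i ≤ l}.indicator 1 j) ^ 2
      = ∑ l ∈ D, if ρ i ≤ l ∧ ¬ρ j ≤ l then (y (l + 1) - y l) ^ 2 else 0 := by
        refine Finset.sum_congr rfl fun l _ => ?_
        by_cases hi : ρ i ≤ l <;> by_cases hj : ρ j ≤ l
        · simp [hi, hj]
        · simp [hi, hj]
        · exact absurd (hij.trans hj) hi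
        · simp [hi, hj]
    _ = ∑ l ∈ D with ρ i ≤ l ∧ ¬ρ j ≤ l, (y (l + 1) - y l) ^ 2 := (Finset.sum_filter _ _).symm
    _ ≤ (z j - z i) ^ 2 := sum_sq_sub_le_sq_sub hy _ fun l hl => by
        obtain ⟨hlD, hil, hlj⟩ := Finset.mem_filter.1 hl
        exact ⟨(hD l hlD).1 i hil, (hD l hlD).2 j hlj⟩
    _ = (z i - z j) ^ 2 := sub_sq_comm _ _

variable [Fintype ι]

/-- The sum of the squared deviations of `z` from its mean, the Lyapunov function of averaging. -/
def spread (z : ι → ℝ) : ℝ := ∑ i, (z i - (∑ j, z j) / Fintype.card ι) ^ 2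

/-- The decrease of `2 ∑ z_i²` under a doubly stochastic matrix `W`, as a sum of squared
differences. -/
def dissipation (W : Matrix ι ι ℝ) (z : ι → ℝ) : ℝ :=
  ∑ i, ∑ j, ∑ k, W i j * W i k * (z j - z k) ^ 2

lemma spread_nonneg (z : ι → ℝ) : 0 ≤ spread z := Finset.sum_nonneg fun _ _ => sq_nonneg _

lemma sq_sub_mean_le_spread (z : ι → ℝ) (i : ι) :
    (z i - (∑ j, z j) / Fintype.card ι) ^ 2 ≤ spread z :=
  Finset.single_le_sum (f := fun i => (z i - (∑ j, z j) / Fintype.card ι) ^ 2)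
    (fun _ _ => sq_nonneg _) (Finset.mem_univ i)

lemma spread_eq (z : ι → ℝ) : spread z = ∑ i, z i ^ 2 - (∑ i, z i) ^ 2 / Fintype.card ι := by
  rcases isEmpty_or_nonempty ι with _ | _
  · simp [spread]
  have hcard : (Fintype.card ι : ℝ) ≠ 0 := by positivity
  set m := ∑ j, z j with hm
  have hsq (i : ι) : (z i - m / Fintype.card ι) ^ 2 =
      z i ^ 2 - 2 * (m / Fintype.card ι) * z i + (m / Fintype.card ι) ^ 2 := by ring
  simp only [spread, ← hm, hsq, Finset.sum_add_distrib, Finset.sum_sub_distrib, ← Finset.mul_sum,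
    Finset.sum_const, Finset.card_univ, nsmul_eq_mul]
  field_simp
  ring

lemma spread_le_of_mem_Icc {z : ι → ℝ} {a b : ℝ} (hz : ∀ i, z i ∈ Icc a b) :
    spread z ≤ Fintype.card ι * (b - a) ^ 2 := by
  rcases isEmpty_or_nonempty ι with _ | _
  · simp [spread]
  have hcard : (0 : ℝ) < Fintype.card ι := by positivity
  have hmean_ge : a ≤ (∑ j, z j) / Fintype.card ι := by
    rw [le_div_iff₀' hcard]
    simpa using Finset.card_nsmul_le_sum Finset.univ z a fun i _ => (hz i).1
  have hmean_le : (∑ j, z j) / Fintype.card ι ≤ b := by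
    rw [div_le_iff₀' hcard]
    simpa using Finset.sum_le_card_nsmul Finset.univ z b fun i _ => (hz i).2
  calc spread z ≤ ∑ _i : ι, (b - a) ^ 2 := Finset.sum_le_sum fun i _ => by
        apply sq_le_sq' <;> linarith [(hz i).1, (hz i).2]
    _ = Fintype.card ι * (b - a) ^ 2 := by simp

lemma sum_sum_mul_mul_sub_sq {w : ι → ℝ} (hw : ∑ j, w j = 1) (z : ι → ℝ) :
    ∑ j, ∑ k, w j * w k * (z j - z k) ^ 2 =
      2 * (∑ j, w j * z j ^ 2 - (∑ j, w j * z j) ^ 2) := by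
  have hexpand (j k : ι) : w j * w k * (z j - z k) ^ 2 =
      (w j * z j ^ 2) * w k - 2 * ((w j * z j) * (w k * z k)) + w j * (w k * z k ^ 2) := by ring
  simp only [hexpand, Finset.sum_add_distrib, Finset.sum_sub_distrib, ← Finset.mul_sum,
    ← Finset.sum_mul, hw]
  ring

lemma le_sum_sum_mul_mul_indicator_sub_sq {w : ι → ℝ} {S : Set ι} {η : ℝ} {a b : ι}
    (hw : ∀ j, 0 ≤ w j) (hsum : ∑ j, w j = 1) (ha : a ∈ S) (hb : b ∉ S) (hwa : η ≤ w a)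
    (hwb : η ≤ w b) :
    η ≤ ∑ j, ∑ k, w j * w k * (S.indicator 1 j - S.indicator 1 k) ^ 2 := by
  classical
  set c : ι → ℝ := S.indicator 1
  set p := ∑ j, w j * c j
  have hc (j : ι) : c j ∈ Icc 0 1 := ⟨indicator_nonneg (fun _ _ => zero_le_one) j,
    indicator_le_self' (fun _ _ => zero_le_one) j⟩
  have hcompl : 1 - p = ∑ j, w j * (1 - c j) := by
    simp only [p, mul_sub, mul_one, Finset.sum_sub_distrib, hsum]
  have hp : w a ≤ p := le_trans (by simp [c, ha]) (Finset.single_le_sum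
    (f := fun j => w j * c j) (fun j _ => mul_nonneg (hw j) (hc j).1) (Finset.mem_univ a))
  have hp' : w b ≤ 1 - p := hcompl ▸ le_trans (by simp [c, hb]) (Finset.single_le_sum
    (f := fun j => w j * (1 - c j))
    (fun j _ => mul_nonneg (hw j) (sub_nonneg.2 (hc j).2)) (Finset.mem_univ b))
  have hsq (j : ι) : c j ^ 2 = c j := by by_cases hj : j ∈ S <;> simp [c, hj]
  rw [sum_sum_mul_mul_sub_sq hsum]
  simp only [hsq]
  change η ≤ 2 * (p - p ^ 2)
  rcases le_total p (1 / 2) with hhalf | hhalf <;> nlinarith [hw a, hw b]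

lemma dissipation_nonneg {W : Matrix ι ι ℝ} (hW : ∀ i j, 0 ≤ W i j) (z : ι → ℝ) :
    0 ≤ dissipation W z :=
  Finset.sum_nonneg fun i _ => Finset.sum_nonneg fun j _ => Finset.sum_nonneg fun k _ =>
    mul_nonneg (mul_nonneg (hW i j) (hW i k)) (sq_nonneg _)

lemma dissipation_eq [DecidableEq ι] {W : Matrix ι ι ℝ} (hW : W ∈ doublyStochastic ℝ ι)
    (z : ι → ℝ) : dissipation W z = 2 * (∑ i, z i ^ 2 - ∑ i, (W *ᵥ z) i ^ 2) := by
  have hcol : ∑ i, ∑ j, W i j * z j ^ 2 = ∑ i, z i ^ 2 :=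
    sum_mulVec_of_mem_doublyStochastic hW (x := fun j => z j ^ 2)
  simp only [dissipation, sum_sum_mul_mul_sub_sq (sum_row_of_mem_doublyStochastic hW _),
    ← Finset.mul_sum, Finset.sum_sub_distrib, hcol, mulVec, dotProduct]

lemma spread_sub_spread_mulVec [DecidableEq ι] {W : Matrix ι ι ℝ}
    (hW : W ∈ doublyStochastic ℝ ι) (z : ι → ℝ) :
    spread z - spread (W *ᵥ z) = dissipation W z / 2 := by
  rw [spread_eq, spread_eq, dissipation_eq hW, sum_mulVec_of_mem_doublyStochastic hW]
  ring

lemma spread_mulVec_le [DecidableEq ι] {W : Matrix ι ι ℝ} (hW : W ∈ doublyStochastic ℝ ι)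
    (z : ι → ℝ) : spread (W *ᵥ z) ≤ spread z := by
  have hdiss : 0 ≤ dissipation W z :=
    dissipation_nonneg (fun _ _ => nonneg_of_mem_doublyStochastic hW) z
  linarith [spread_sub_spread_mulVec hW z]

lemma sum_gap_sq_mul_dissipation_indicator_le {W : Matrix ι ι ℝ} (hW : ∀ i j, 0 ≤ W i j)
    {y : ℕ → ℝ} (hy : Monotone y) {z : ι → ℝ} {ρ : ι → ℕ} {D : Finset ℕ}
    (hD : ∀ l ∈ D, Separates z {i | ρ i ≤ l} (y l) (y (l + 1))) :
    ∑ l ∈ D, (y (l + 1) - y l) ^ 2 * dissipation W ({i | ρ i ≤ l}.indicator 1) ≤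
      dissipation W z := by
  simp only [dissipation, Finset.mul_sum]
  rw [Finset.sum_comm]
  refine Finset.sum_le_sum fun i _ => ?_
  rw [Finset.sum_comm]
  refine Finset.sum_le_sum fun j _ => ?_
  rw [Finset.sum_comm]
  refine Finset.sum_le_sum fun k _ => ?_
  simp only [mul_left_comm _ (W i j * W i k), ← Finset.mul_sum]
  exact mul_le_mul_of_nonneg_left (sum_gap_sq_mul_indicator_sub_sq_le hy hD j k)
    (mul_nonneg (hW i j) (hW i k))

lemma exists_monotone_enumeration {n : ℕ} (z : Fin n → ℝ) :
    ∃ (σ : Equiv.Perm (Fin n)) (y : ℕ → ℝ), Monotone y ∧ ∀ i, z i = y (σ i) := by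
  cases n with
  | zero => exact ⟨1, 0, monotone_const, fun i => i.elim0⟩
  | succ n =>
    let clamp (l : ℕ) : Fin (n + 1) := ⟨min l n, by omega⟩
    refine ⟨(Tuple.sort z).symm, fun l => z (Tuple.sort z (clamp l)), fun a b hab =>
      Tuple.monotone_sort z (show clamp a ≤ clamp b from min_le_min_right n hab), fun i => ?_⟩
    have hclamp : clamp ((Tuple.sort z).symm i) = (Tuple.sort z).symm i :=
      Fin.ext (min_eq_left (by omega))
    simp only [hclamp, Equiv.apply_symm_apply]

lemma spread_le_sum_gap_sq {n : ℕ} {y : ℕ → ℝ} (hy : Monotone y) {z : Fin n → ℝ}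
    {σ : Equiv.Perm (Fin n)} (hz : ∀ i, z i = y (σ i)) :
    spread z ≤ (n : ℝ) ^ 2 * ∑ l ∈ Finset.range (n - 1), (y (l + 1) - y l) ^ 2 := by
  have hrange : (y (n - 1) - y 0) ^ 2 ≤
      n * ∑ l ∈ Finset.range (n - 1), (y (l + 1) - y l) ^ 2 := by
    rw [← Finset.sum_range_sub]
    refine sq_sum_le_card_mul_sum_sq.trans ?_
    rw [Finset.card_range]
    gcongr
    omega
  calc spread z ≤ Fintype.card (Fin n) * (y (n - 1) - y 0) ^ 2 :=
        spread_le_of_mem_Icc fun i => hz i ▸ ⟨hy (Nat.zero_le _), hy (by omega)⟩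
    _ ≤ n * (n * ∑ l ∈ Finset.range (n - 1), (y (l + 1) - y l) ^ 2) := by
        rw [Fintype.card_fin]; gcongr
    _ = (n : ℝ) ^ 2 * ∑ l ∈ Finset.range (n - 1), (y (l + 1) - y l) ^ 2 := by ring

end Averaging

section Consensus

open Matrix

/-- Some edge of `G` joins `S` to its complement. -/
def Crosses {ι : Type*} (G : Digraph ι) (S : Set ι) : Prop :=
  ∃ i j, G.Adj j i ∧ ¬(i ∈ S ↔ j ∈ S)

lemma exists_crossing_of_reflTransGen {ι : Type*} {r : ι → ι → Prop} {S : Set ι} {a b : ι}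
    (hab : Relation.ReflTransGen r a b) (ha : a ∈ S) (hb : b ∉ S) : ∃ c ∈ S, ∃ d ∉ S, r c d := by
  induction hab with
  | refl => exact absurd ha hb
  | @tail c d _ hcd ih =>
    by_cases hc : c ∈ S
    · exact ⟨c, hc, d, hb, hcd⟩
    · exact ih hc

namespace IsMixing

variable {n B : ℕ} {η : ℝ} {G : ℕ → Digraph (Fin n)} {W : ℕ → Matrix (Fin n) (Fin n) ℝ}

lemma mem_doublyStochastic (h : IsMixing η B G W) (hη : 0 < η) (t : ℕ) :
    W t ∈ doublyStochastic ℝ (Fin n) := by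
  refine mem_doublyStochastic_iff_sum.2 ⟨fun i j => ?_, h.row_sum t, h.col_sum t⟩
  by_cases hadj : (G t).Adj j i
  · exact hη.le.trans (h.le_weight t i j hadj)
  · exact (h.weight_eq_zero t i j hadj).ge

lemma weight_nonneg (h : IsMixing η B G W) (hη : 0 < η) (t : ℕ) (i j : Fin n) : 0 ≤ W t i j :=
  nonneg_of_mem_doublyStochastic (h.mem_doublyStochastic hη t)

lemma le_dissipation_indicator (h : IsMixing η B G W) (hη : 0 < η) {t : ℕ} {S : Set (Fin n)}
    (hS : Crosses (G t) S) : η ≤ dissipation (W t) (S.indicator 1) := by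
  obtain ⟨i, j, hadj, hij⟩ := hS
  have hrow : η ≤ ∑ a, ∑ b, W t i a * W t i b * (S.indicator 1 a - S.indicator 1 b) ^ 2 := by
    have hself := h.le_weight t i i (h.self_loop t i)
    have hedge := h.le_weight t i j hadj
    have hnonneg := h.weight_nonneg hη t i
    by_cases hi : i ∈ S <;> by_cases hj : j ∈ S
    · simp [hi, hj] at hij
    · exact le_sum_sum_mul_mul_indicator_sub_sq hnonneg (h.row_sum t i) hi hj hself hedge
    · exact le_sum_sum_mul_mul_indicator_sub_sq hnonneg (h.row_sum t i) hj hi hedge hself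
    · simp [hi, hj] at hij
  refine hrow.trans (Finset.single_le_sum (f := fun i => ∑ a, ∑ b,
    W t i a * W t i b * (S.indicator 1 a - S.indicator 1 b) ^ 2) (fun i _ => ?_)
    (Finset.mem_univ i))
  exact Finset.sum_nonneg fun a _ => Finset.sum_nonneg fun b _ =>
    mul_nonneg (mul_nonneg (h.weight_nonneg hη t i a) (h.weight_nonneg hη t i b)) (sq_nonneg _)

lemma separates_mulVec (h : IsMixing η B G W) (hη : 0 < η) {t : ℕ} {z : Fin n → ℝ}
    {S : Set (Fin n)} {a b : ℝ} (hz : Separates z S a b) (hS : ¬Crosses (G t) S) :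
    Separates (W t *ᵥ z) S a b := by
  have hside (i j : Fin n) (hadj : (G t).Adj j i) : i ∈ S ↔ j ∈ S :=
    not_not.1 fun hij => hS ⟨i, j, hadj, hij⟩
  have hconst (i : Fin n) (c : ℝ) : c = ∑ j, W t i j * c := by
    rw [← Finset.sum_mul, h.row_sum, one_mul]
  simp only [Separates, mulVec, dotProduct]
  refine ⟨fun i hi => ?_, fun i hi => ?_⟩
  · rw [hconst i a]
    refine Finset.sum_le_sum fun j _ => ?_
    by_cases hadj : (G t).Adj j i
    · exact mul_le_mul_of_nonneg_left (hz.1 j ((hside i j hadj).1 hi)) (h.weight_nonneg hη t i j)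
    · simp [h.weight_eq_zero t i j hadj]
  · rw [hconst i b]
    refine Finset.sum_le_sum fun j _ => ?_
    by_cases hadj : (G t).Adj j i
    · exact mul_le_mul_of_nonneg_left (hz.2 j (mt (hside i j hadj).2 hi))
        (h.weight_nonneg hη t i j)
    · simp [h.weight_eq_zero t i j hadj]

lemma separates_of_not_crosses (h : IsMixing η B G W) (hη : 0 < η) {k : ℕ} {z : ℕ → Fin n → ℝ}
    (hz : ∀ t, z (t + 1) = W (k + t) *ᵥ z t) {S : Set (Fin n)} {a b : ℝ}
    (h₀ : Separates (z 0) S a b) {t : ℕ} (hS : ∀ s < t, ¬Crosses (G (k + s)) S) :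
    Separates (z t) S a b := by
  induction t with
  | zero => exact h₀
  | succ t ih =>
    rw [hz t]
    exact h.separates_mulVec hη (ih fun s hs => hS s (hs.trans t.lt_succ_self))
      (hS t t.lt_succ_self)

lemma exists_first_crossing (h : IsMixing η B G W) (k : ℕ) {S : Set (Fin n)} {a b : Fin n}
    (ha : a ∈ S) (hb : b ∉ S) :
    ∃ t < B, Crosses (G (k + t)) S ∧ ∀ s < t, ¬Crosses (G (k + s)) S := by
  classical
  obtain ⟨c, hc, d, hd, t, hkt, htB, hadj⟩ :=
    exists_crossing_of_reflTransGen (h.connected k a b) ha hb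
  have hcross : Crosses (G (k + (t - k))) S :=
    ⟨d, c, by rwa [Nat.add_sub_cancel' hkt], fun hdc => hd (hdc.2 hc)⟩
  have hex : ∃ t, Crosses (G (k + t)) S := ⟨t - k, hcross⟩
  exact ⟨Nat.find hex, (Nat.find_min' hex hcross).trans_lt (by omega), Nat.find_spec hex,
    fun s hs => Nat.find_min hex hs⟩

lemma sum_gap_sq_le_spread_sub_spread_mulVec (h : IsMixing η B G W) (hη : 0 < η) {t : ℕ}
    {y : ℕ → ℝ} (hy : Monotone y) {z : Fin n → ℝ} {ρ : Fin n → ℕ} {D : Finset ℕ}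
    (hsep : ∀ l ∈ D, Separates z {i | ρ i ≤ l} (y l) (y (l + 1)))
    (hcross : ∀ l ∈ D, Crosses (G t) {i | ρ i ≤ l}) :
    η / 2 * ∑ l ∈ D, (y (l + 1) - y l) ^ 2 ≤ spread z - spread (W t *ᵥ z) := by
  have hdiss : ∑ l ∈ D, (y (l + 1) - y l) ^ 2 * η ≤ dissipation (W t) z :=
    (Finset.sum_le_sum fun l hl => mul_le_mul_of_nonneg_left
      (h.le_dissipation_indicator hη (hcross l hl)) (sq_nonneg _)).trans
      (sum_gap_sq_mul_dissipation_indicator_le (h.weight_nonneg hη t) hy hsep)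
  rw [spread_sub_spread_mulVec (h.mem_doublyStochastic hη t)]
  rw [← Finset.sum_mul] at hdiss
  linarith

/- The gap between two consecutive order statistics of `z 0` persists until an edge first crosses
the cut between them, which happens within `B` steps; at that moment it is dissipated. -/
lemma sum_gap_sq_le_spread_sub_spread (h : IsMixing η B G W) (hη : 0 < η) {k : ℕ}
    {z : ℕ → Fin n → ℝ} (hz : ∀ t, z (t + 1) = W (k + t) *ᵥ z t) {y : ℕ → ℝ} (hy : Monotone y)
    {σ : Equiv.Perm (Fin n)} (hzy : ∀ i, z 0 i = y (σ i)) :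
    η / 2 * ∑ l ∈ Finset.range (n - 1), (y (l + 1) - y l) ^ 2 ≤ spread (z 0) - spread (z B) := by
  let cut (l : ℕ) : Set (Fin n) := {i | (σ i : ℕ) ≤ l}
  have hfirst (l : ℕ) : ∃ t, l ∈ Finset.range (n - 1) →
      t < B ∧ Crosses (G (k + t)) (cut l) ∧ ∀ s < t, ¬Crosses (G (k + s)) (cut l) := by
    by_cases hl : l ∈ Finset.range (n - 1)
    · have hln := Finset.mem_range.1 hl
      have hin : σ.symm ⟨l, by omega⟩ ∈ cut l := by simp [cut]
      have hout : σ.symm ⟨l + 1, by omega⟩ ∉ cut l := by simp [cut]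
      obtain ⟨t, ht⟩ := h.exists_first_crossing k hin hout
      exact ⟨t, fun _ => ht⟩
    · exact ⟨0, fun hl' => absurd hl' hl⟩
  choose τ hτ using hfirst
  have hsep₀ (l : ℕ) : Separates (z 0) (cut l) (y l) (y (l + 1)) :=
    ⟨fun i hi => hzy i ▸ hy hi, fun i hi => hzy i ▸ hy (Nat.lt_of_not_le hi)⟩
  have hstep (t : ℕ) : η / 2 * ∑ l ∈ Finset.range (n - 1) with τ l = t, (y (l + 1) - y l) ^ 2 ≤
      spread (z t) - spread (z (t + 1)) := by
    rw [hz t]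
    refine h.sum_gap_sq_le_spread_sub_spread_mulVec hη hy (ρ := fun i => σ i) ?_ ?_ <;>
      intro l hl <;> obtain ⟨hl', rfl⟩ := Finset.mem_filter.1 hl
    · exact h.separates_of_not_crosses hη hz (hsep₀ l) (hτ l hl').2.2
    · exact (hτ l hl').2.1
  rw [← Finset.sum_range_sub' (fun t => spread (z t)) B, ← Finset.sum_fiberwise_of_maps_to
    (g := τ) fun l hl => Finset.mem_range.2 (hτ l hl).1, Finset.mul_sum]
  exact Finset.sum_le_sum fun t _ => hstep t

theorem spread_window_le (h : IsMixing η B G W) (hη : 0 < η) {k : ℕ} {z : ℕ → Fin n → ℝ}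
    (hz : ∀ t, z (t + 1) = W (k + t) *ᵥ z t) :
    spread (z B) ≤ (1 - η / (2 * (n : ℝ) ^ 2)) * spread (z 0) := by
  rcases Nat.eq_zero_or_pos n with rfl | hn
  · simp [spread]
  obtain ⟨σ, y, hy, hzy⟩ := exists_monotone_enumeration (z 0)
  have hgaps : η / (2 * (n : ℝ) ^ 2) * spread (z 0) ≤
      η / 2 * ∑ l ∈ Finset.range (n - 1), (y (l + 1) - y l) ^ 2 := by
    calc η / (2 * (n : ℝ) ^ 2) * spread (z 0) ≤ η / (2 * (n : ℝ) ^ 2) *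
          ((n : ℝ) ^ 2 * ∑ l ∈ Finset.range (n - 1), (y (l + 1) - y l) ^ 2) := by
          gcongr; exact spread_le_sum_gap_sq hy hzy
      _ = η / 2 * ∑ l ∈ Finset.range (n - 1), (y (l + 1) - y l) ^ 2 := by field_simp
  linarith [h.sum_gap_sq_le_spread_sub_spread hη hz hy hzy]

end IsMixing

/-- The contraction factor `1 - η / (4 n²)`, of which `Γ` and `θ` are powers. -/
def rate (η : ℝ) (n : ℕ) : ℝ := 1 - η / (4 * (n : ℝ) ^ 2)

lemma Gam_eq_rate (η : ℝ) (n : ℕ) : Gam η n = (rate η n ^ 2)⁻¹ := rfl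

lemma theta_eq_rate (η : ℝ) (n B : ℕ) : theta η n B = rate η n ^ (1 / (B : ℝ)) := rfl

section Rate

variable {η : ℝ} {n B : ℕ}

lemma rate_pos (hη1 : η < 1) : 0 < rate η n := by
  rcases Nat.eq_zero_or_pos n with rfl | hn
  · simp [rate]
  have hn' : (1 : ℝ) ≤ n := by exact_mod_cast hn
  rw [rate, sub_pos, div_lt_one (by positivity)]
  nlinarith

lemma rate_le_one (hη : 0 < η) : rate η n ≤ 1 := sub_le_self _ (by positivity)

lemma rate_lt_one (hη : 0 < η) (hn : 0 < n) : rate η n < 1 := sub_lt_self _ (by positivity)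

lemma one_sub_div_le_rate_sq : 1 - η / (2 * (n : ℝ) ^ 2) ≤ rate η n ^ 2 := by
  have hhalf : η / (2 * (n : ℝ) ^ 2) = 2 * (η / (4 * (n : ℝ) ^ 2)) := by ring
  rw [rate, hhalf]
  nlinarith [sq_nonneg (η / (4 * (n : ℝ) ^ 2))]

lemma Gam_pos (hη1 : η < 1) : 0 < Gam η n := inv_pos.2 (pow_pos (rate_pos hη1) 2)

lemma theta_pos (hη1 : η < 1) : 0 < theta η n B := Real.rpow_pos_of_pos (rate_pos hη1) _

lemma theta_lt_one (hη : 0 < η) (hη1 : η < 1) (hn : 0 < n) (hB : 1 ≤ B) : theta η n B < 1 :=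
  Real.rpow_lt_one (rate_pos hη1).le (rate_lt_one hη hn)
    (one_div_pos.2 (by exact_mod_cast hB))

lemma Gam_mul_theta_pow (hη1 : η < 1) (m : ℕ) :
    Gam η n * theta η n B ^ m = rate η n ^ ((m : ℝ) / B - 2) := by
  have hr := rate_pos (n := n) hη1
  rw [theta_eq_rate, Gam_eq_rate, ← Real.rpow_mul_natCast hr.le, ← Real.rpow_natCast,
    ← Real.rpow_neg hr.le, ← Real.rpow_add hr]
  congr 1
  push_cast
  ring

lemma rate_pow_div_le (hη : 0 < η) (hη1 : η < 1) (hB : 1 ≤ B) (m : ℕ) :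
    rate η n ^ (m / B) ≤ Gam η n * theta η n B ^ m := by
  rw [Gam_mul_theta_pow hη1, ← Real.rpow_natCast]
  refine Real.rpow_le_rpow_of_exponent_ge (rate_pos hη1) (rate_le_one hη) ?_
  have hdiv : (m : ℝ) / B < (m / B : ℕ) + 1 := by
    rw [div_lt_iff₀ (by exact_mod_cast hB)]
    exact_mod_cast Nat.lt_mul_of_div_lt (Nat.lt_succ_self (m / B)) hB
  linarith

end Rate

/-- The product `W (s + m - 1) ⋯ W s` of the mixing matrices. -/
def transition {n : ℕ} (W : ℕ → Matrix (Fin n) (Fin n) ℝ) (s : ℕ) :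
    ℕ → Matrix (Fin n) (Fin n) ℝ
  | 0 => 1
  | m + 1 => W (s + m) * transition W s m

namespace IsMixing

variable {n B : ℕ} {η : ℝ} {G : ℕ → Digraph (Fin n)} {W : ℕ → Matrix (Fin n) (Fin n) ℝ}

lemma spread_antitone (h : IsMixing η B G W) (hη : 0 < η) {k : ℕ} {z : ℕ → Fin n → ℝ}
    (hz : ∀ t, z (t + 1) = W (k + t) *ᵥ z t) : Antitone fun t => spread (z t) :=
  antitone_nat_of_succ_le fun t => by
    rw [hz t]; exact spread_mulVec_le (h.mem_doublyStochastic hη _) _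

lemma spread_mul_le (h : IsMixing η B G W) (hη : 0 < η) {k : ℕ} {z : ℕ → Fin n → ℝ}
    (hz : ∀ t, z (t + 1) = W (k + t) *ᵥ z t) (q : ℕ) :
    spread (z (q * B)) ≤ (rate η n ^ q) ^ 2 * spread (z 0) := by
  induction q with
  | zero => simp
  | succ q ih =>
    have hwindow := h.spread_window_le hη (k := k + q * B) (z := fun t => z (q * B + t))
      fun t => by rw [add_assoc k]; exact hz (q * B + t)
    calc spread (z ((q + 1) * B)) = spread (z (q * B + B)) := by rw [add_mul, one_mul]
      _ ≤ (1 - η / (2 * (n : ℝ) ^ 2)) * spread (z (q * B)) := hwindow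
      _ ≤ rate η n ^ 2 * ((rate η n ^ q) ^ 2 * spread (z 0)) :=
          mul_le_mul one_sub_div_le_rate_sq ih (spread_nonneg _) (sq_nonneg _)
      _ = (rate η n ^ (q + 1)) ^ 2 * spread (z 0) := by ring

theorem abs_transition_sub_le (h : IsMixing η B G W) (hη : 0 < η) (hη1 : η < 1) (s m : ℕ)
    (i j : Fin n) : |transition W s m i j - 1 / n| ≤ Gam η n * theta η n B ^ m := by
  refine le_trans ?_ (rate_pow_div_le hη hη1 h.one_le m)
  set z : ℕ → Fin n → ℝ := fun m a => transition W s m a j with hzdef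
  have hz (t : ℕ) : z (t + 1) = W (s + t) *ᵥ z t := by
    ext a; simp [hzdef, transition, mul_apply, mulVec, dotProduct]
  have hsum (t : ℕ) : ∑ a, z t a = 1 := by
    induction t with
    | zero => simp [hzdef, transition, one_apply]
    | succ t ih => rw [hz, sum_mulVec_of_mem_doublyStochastic (h.mem_doublyStochastic hη _), ih]
  have hspread₀ : spread (z 0) ≤ 1 := by
    have hsq : ∑ a, z 0 a ^ 2 = 1 := by simp [hzdef, transition, one_apply]
    rw [spread_eq, hsum, hsq]
    exact sub_le_self _ (by positivity)
  refine abs_le_of_sq_le_sq ?_ (pow_nonneg (rate_pos hη1).le _)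
  calc (transition W s m i j - 1 / n) ^ 2
      = (z m i - (∑ a, z m a) / Fintype.card (Fin n)) ^ 2 := by rw [hsum, Fintype.card_fin]
    _ ≤ spread (z m) := sq_sub_mean_le_spread (z m) i
    _ ≤ spread (z (m / B * B)) := h.spread_antitone hη hz (Nat.div_mul_le_self m B)
    _ ≤ (rate η n ^ (m / B)) ^ 2 * spread (z 0) := h.spread_mul_le hη hz _
    _ ≤ (rate η n ^ (m / B)) ^ 2 := mul_le_of_le_one_right (sq_nonneg _) hspread₀

end IsMixing

end Consensus

section StrongConvexity

variable {E : Type*} [NormedAddCommGroup E] [NormedSpace ℝ E] {X : Set E} {f : E → ℝ} {m : ℝ}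
  {p q x : E}

lemma dual_apply_le_half_sq_add_half_sq (y : StrongDual ℝ E) (v : E) :
    y v ≤ 1 / 2 * ‖y‖ ^ 2 + 1 / 2 * ‖v‖ ^ 2 := by
  have := (le_abs_self _).trans (y.le_opNorm v)
  nlinarith [sq_nonneg (‖y‖ - ‖v‖)]

lemma norm_le_norm_of_sq_le_dual_apply {y : StrongDual ℝ E} {v : E} (h : ‖v‖ ^ 2 ≤ y v) :
    ‖v‖ ≤ ‖y‖ := by
  rcases (norm_nonneg v).eq_or_lt with hv | hv
  · exact hv ▸ norm_nonneg y
  · refine le_of_mul_le_mul_right ?_ hv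
    calc ‖v‖ * ‖v‖ = ‖v‖ ^ 2 := (sq _).symm
      _ ≤ y v := h
      _ ≤ ‖y‖ * ‖v‖ := (le_abs_self _).trans (y.le_opNorm v)

lemma tendsto_slope_fderivWithin (hX : Convex ℝ X) (hf : DifferentiableWithinAt ℝ f X p)
    (hp : p ∈ X) (hx : x ∈ X) :
    Tendsto (fun a : ℝ => a⁻¹ * (f (p + a • (x - p)) - f p)) (𝓝[>] 0)
      (𝓝 (fderivWithin ℝ f X p (x - p))) := by
  have h0 : Tendsto (fun a : ℝ => a) (𝓝[>] 0) (𝓝 0) := nhdsWithin_le_nhds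
  refine hf.hasFDerivWithinAt.lim (c := fun a => a⁻¹) (d := fun a => a • (x - p)) ?_ ?_ ?_
  · simpa only [zero_smul] using h0.smul_const (x - p)
  · filter_upwards [Ioc_mem_nhdsGT zero_lt_one] with a ha
    exact hX.add_smul_sub_mem hp hx ⟨ha.1.le, ha.2⟩
  · refine tendsto_const_nhds.congr' ?_
    filter_upwards [self_mem_nhdsWithin] with a ha
    rw [inv_smul_smul₀ (ne_of_gt ha)]

lemma slope_add_le_of_strongConvexOn (hf : StrongConvexOn X m f) (hp : p ∈ X) (hx : x ∈ X)
    {a : ℝ} (ha : a ∈ Ioc 0 1) :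
    a⁻¹ * (f (p + a • (x - p)) - f p) + (1 - a) * (m / 2 * ‖x - p‖ ^ 2) ≤ f x - f p := by
  have h := hf.2 hx hp ha.1.le (sub_nonneg.2 ha.2) (add_sub_cancel a 1)
  have hcomb : a • x + (1 - a) • p = p + a • (x - p) := by module
  rw [hcomb] at h
  simp only [smul_eq_mul] at h
  have hslope : a⁻¹ * (f (p + a • (x - p)) - f p) ≤
      f x - f p - (1 - a) * (m / 2 * ‖x - p‖ ^ 2) := by
    rw [inv_mul_le_iff₀ ha.1]
    linarith
  linarith

lemma tendsto_one_sub_mul_nhdsGT_zero (c : ℝ) :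
    Tendsto (fun a : ℝ => (1 - a) * c) (𝓝[>] 0) (𝓝 c) := by
  have h : Tendsto (fun a : ℝ => (1 - a) * c) (𝓝 0) (𝓝 ((1 - 0) * c)) :=
    Continuous.tendsto (by fun_prop) 0
  simpa only [sub_zero, one_mul] using h.mono_left nhdsWithin_le_nhds

lemma fderivWithin_add_sq_le_of_strongConvexOn (hf : StrongConvexOn X m f)
    (hd : DifferentiableWithinAt ℝ f X p) (hp : p ∈ X) (hx : x ∈ X) :
    fderivWithin ℝ f X p (x - p) + m / 2 * ‖x - p‖ ^ 2 ≤ f x - f p := by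
  refine le_of_tendsto
    ((tendsto_slope_fderivWithin hf.1 hd hp hx).add (tendsto_one_sub_mul_nhdsGT_zero _)) ?_
  filter_upwards [Ioc_mem_nhdsGT zero_lt_one] with a ha
  exact slope_add_le_of_strongConvexOn hf hp hx ha

lemma add_sq_le_of_strongConvexOn_of_isMinOn (hf : StrongConvexOn X m f) (hmin : IsMinOn f X q)
    (hq : q ∈ X) (hx : x ∈ X) : f q + m / 2 * ‖x - q‖ ^ 2 ≤ f x := by
  rw [← le_sub_iff_add_le']
  refine le_of_tendsto (tendsto_one_sub_mul_nhdsGT_zero _) ?_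
  filter_upwards [Ioc_mem_nhdsGT zero_lt_one] with a ha
  have hmem := hf.1.add_smul_sub_mem hq hx ⟨ha.1.le, ha.2⟩
  have hslope : 0 ≤ a⁻¹ * (f (q + a • (x - q)) - f q) :=
    mul_nonneg (inv_nonneg.2 ha.1.le) (sub_nonneg.2 (hmin hmem))
  linarith [slope_add_le_of_strongConvexOn hf hq hx ha]

lemma strongConvexOn_add_dual_add_const (hf : StrongConvexOn X m f) (y : StrongDual ℝ E)
    (c : ℝ) : StrongConvexOn X m (fun x => f x + y x + c) := by
  refine ⟨hf.1, fun x hx z hz a b ha hb hab => ?_⟩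
  have h := hf.2 hx hz ha hb hab
  have hc : c = a * c + b * c := by rw [← add_mul, hab, one_mul]
  simp only [map_add, map_smul, smul_eq_mul] at h ⊢
  linarith

end StrongConvexity

section Bregman

variable {E : Type*} [NormedAddCommGroup E] [NormedSpace ℝ E] {X : Set E} {ψ : E → ℝ}
  {p q x : E} {y : StrongDual ℝ E}

lemma bregman_self (X : Set E) (ψ : E → ℝ) (p : E) : bregman X ψ p p = 0 := by
  rw [bregman, sub_self, sub_self, map_zero, sub_zero]

lemma IsRegularizer.strongConvexOn_bregman (h : IsRegularizer X ψ) (p : E) :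
    StrongConvexOn X 1 (fun x => bregman X ψ x p) := by
  convert strongConvexOn_add_dual_add_const h.strongConvexOn (-fderivWithin ℝ ψ X p)
    (-ψ p + fderivWithin ℝ ψ X p p) using 2 with x
  simp only [bregman, map_sub, neg_apply]
  ring

lemma IsRegularizer.continuousOn_bregman (h : IsRegularizer X ψ) (p : E) :
    ContinuousOn (fun x => bregman X ψ x p) X := by
  have := h.differentiableOn.continuousOn
  unfold bregman
  fun_prop

lemma IsRegularizer.sq_le_bregman (h : IsRegularizer X ψ) (hx : x ∈ X) (hp : p ∈ X) :
    1 / 2 * ‖x - p‖ ^ 2 ≤ bregman X ψ x p := by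
  rw [bregman]
  linarith [fderivWithin_add_sq_le_of_strongConvexOn h.strongConvexOn
    (h.differentiableOn p hp) hp hx]

lemma IsRegularizer.bregman_nonneg (h : IsRegularizer X ψ) (hx : x ∈ X) (hp : p ∈ X) :
    0 ≤ bregman X ψ x p :=
  le_trans (by positivity) (h.sq_le_bregman hx hp)

lemma IsRegularizer.bregman_le (h : IsRegularizer X ψ) (hx : x ∈ X) (hp : p ∈ X) :
    bregman X ψ x p ≤ bregmanDiamSq X ψ :=
  le_csSup h.bddAbove ⟨x, hx, p, hp, rfl⟩

lemma IsRegularizer.prox_three_point (h : IsRegularizer X ψ) (hq : IsProx X ψ p y q)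
    (hx : x ∈ X) :
    y (x - q) ≤ bregman X ψ x p - bregman X ψ x q - bregman X ψ q p := by
  have hX : Convex ℝ X := h.strongConvexOn.1
  have first_order : y (x - q) + fderivWithin ℝ ψ X p (x - q) ≤
      fderivWithin ℝ ψ X q (x - q) := by
    refine ge_of_tendsto
      (tendsto_slope_fderivWithin hX (h.differentiableOn q hq.1) hq.1 hx) ?_
    filter_upwards [Ioc_mem_nhdsGT zero_lt_one] with a ha
    have hopt := hq.2 _ (hX.add_smul_sub_mem hq.1 hx ⟨ha.1.le, ha.2⟩)
    rw [le_inv_mul_iff₀ ha.1]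
    simp only [bregman, map_sub, map_add, map_smul, smul_eq_mul] at hopt ⊢
    linarith
  simp only [bregman, map_sub] at first_order ⊢
  linarith

lemma IsRegularizer.norm_prox_sub_le (h : IsRegularizer X ψ) (hp : p ∈ X)
    (hq : IsProx X ψ p y q) : ‖q - p‖ ≤ ‖y‖ := by
  refine norm_le_norm_of_sq_le_dual_apply ?_
  have htp := h.prox_three_point hq hp
  have hpq := h.sq_le_bregman hp hq.1
  have hqp := h.sq_le_bregman hq.1 hp
  rw [bregman_self] at htp
  rw [norm_sub_rev] at hpq
  simp only [map_sub] at htp ⊢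
  linarith

lemma IsRegularizer.prox_descent (h : IsRegularizer X ψ) (hp : p ∈ X) (hq : IsProx X ψ p y q)
    (hx : x ∈ X) : y (x - p) ≤ bregman X ψ x p - bregman X ψ x q + 1 / 2 * ‖y‖ ^ 2 := by
  have htp := h.prox_three_point hq hx
  have hqp := h.sq_le_bregman hq.1 hp
  have hyoung := dual_apply_le_half_sq_add_half_sq y (q - p)
  simp only [map_sub] at htp hyoung ⊢
  linarith

end Bregman

section MirrorMap

variable {E : Type*} [NormedAddCommGroup E] [NormedSpace ℝ E] {X : Set E} {φ : E → ℝ}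
  {π : StrongDual ℝ E → E}

/-- `π` is a mirror map of the regularizer `φ` on `X`, as used by dual averaging: `π S` is a
maximizer over `X` of the regularized gain `S x - φ x`. -/
def IsMirrorMap (X : Set E) (φ : E → ℝ) (π : StrongDual ℝ E → E) : Prop :=
  ∀ S, π S ∈ X ∧ ∀ x ∈ X, S x - φ x ≤ S (π S) - φ (π S)

lemma exists_isMirrorMap (hX : IsCompact X) (hne : X.Nonempty) (hφ : ContinuousOn φ X) :
    ∃ π, IsMirrorMap X φ π := by
  have hmax (S : StrongDual ℝ E) : ∃ q ∈ X, ∀ x ∈ X, S x - φ x ≤ S q - φ q :=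
    hX.exists_isMaxOn hne (S.continuous.continuousOn.sub hφ)
  choose π hπ using hmax
  exact ⟨π, hπ⟩

lemma IsMirrorMap.add_sq_le (hπ : IsMirrorMap X φ π) (hφ : StrongConvexOn X 1 φ)
    (S : StrongDual ℝ E) {x : E} (hx : x ∈ X) :
    S x - φ x + 1 / 2 * ‖x - π S‖ ^ 2 ≤ S (π S) - φ (π S) := by
  have hmin : IsMinOn (fun x => φ x + (-S) x + 0) X (π S) := fun x hx => by
    simp only [mem_ofPred_eq, neg_apply]
    linarith [(hπ S).2 x hx]
  have := add_sq_le_of_strongConvexOn_of_isMinOn (strongConvexOn_add_dual_add_const hφ (-S) 0)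
    hmin (hπ S).1 hx
  simp only [neg_apply] at this
  linarith

lemma IsMirrorMap.lipschitzWith (hπ : IsMirrorMap X φ π) (hφ : StrongConvexOn X 1 φ) :
    LipschitzWith 1 π := by
  refine LipschitzWith.mk_one fun S T => ?_
  rw [dist_eq_norm, dist_eq_norm]
  refine norm_le_norm_of_sq_le_dual_apply ?_
  have hS := hπ.add_sq_le hφ S (hπ T).1
  have hT := hπ.add_sq_le hφ T (hπ S).1
  rw [norm_sub_rev] at hS
  simp only [sub_apply, map_sub]
  linarith

lemma IsMirrorMap.regret_le (hπ : IsMirrorMap X φ π) (hφ : StrongConvexOn X 1 φ)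
    (hφ0 : ∀ x ∈ X, 0 ≤ φ x) (y : ℕ → StrongDual ℝ E) (T : ℕ) {x : E} (hx : x ∈ X) :
    ∑ t ∈ Finset.range T, y t (x - π (∑ s ∈ Finset.range t, y s)) ≤
      φ x + ∑ t ∈ Finset.range T, 1 / 2 * ‖y t‖ ^ 2 := by
  have potential (T : ℕ) : ∀ x ∈ X, (∑ s ∈ Finset.range T, y s) x - φ x ≤
      ∑ t ∈ Finset.range T, (y t (π (∑ s ∈ Finset.range t, y s)) + 1 / 2 * ‖y t‖ ^ 2) := by
    induction T with
    | zero => intro x hx; simpa using hφ0 x hx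
    | succ T ih =>
      intro x hx
      rw [Finset.sum_range_succ, Finset.sum_range_succ (fun t => y t _ + _), add_apply]
      set S := ∑ s ∈ Finset.range T, y s
      have hstep := hπ.add_sq_le hφ S hx
      have hyoung := dual_apply_le_half_sq_add_half_sq (y T) (x - π S)
      rw [map_sub] at hyoung
      linarith [ih (π S) (hπ S).1]
  have := potential T x hx
  simp only [map_sub, Finset.sum_sub_distrib, Finset.sum_add_distrib, sum_apply] at this ⊢
  linarith

end MirrorMap

section Measurability

variable {Ω E : Type*} [NormedAddCommGroup E] {X : Set E} {m : MeasurableSpace Ω}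

section Minimizer

variable {d : ℕ → X} {f : E → ℝ} {q : E}

lemma exists_dist_lt_and_lt_add_of_denseRange (hd : DenseRange d) (hf : ContinuousOn f X)
    (hq : q ∈ X) {ε : ℝ} (hε : 0 < ε) : ∃ k, dist (d k : E) q < ε ∧ f (d k) < f q + ε := by
  have hc : Continuous fun x : X => f x := continuousOn_iff_continuous_domRestrict.1 hf
  have hopen : IsOpen {x : X | dist (x : E) q < ε ∧ f x < f q + ε} :=
    (isOpen_lt (continuous_subtype_val.dist continuous_const) continuous_const).inter
      (isOpen_lt hc continuous_const)
  exact hd.exists_mem_open hopen ⟨⟨q, hq⟩, by simpa using hε⟩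

lemma dist_le_sqrt_of_add_sq_le (hd : DenseRange d) (hf : ContinuousOn f X) (hq : q ∈ X)
    (hgrowth : ∀ x ∈ X, f q + 1 / 2 * ‖x - q‖ ^ 2 ≤ f x) {ε : ℝ} {x : X}
    (hx : ∀ j, f x ≤ f (d j) + ε) : dist (x : E) q ≤ √(2 * ε) := by
  have near_min : f x ≤ f q + ε := by
    refine le_of_forall_pos_lt_add fun δ hδ => ?_
    obtain ⟨j, -, hj⟩ := exists_dist_lt_and_lt_add_of_denseRange hd hf hq hδ
    linarith [hx j]
  rw [dist_eq_norm]
  refine Real.le_sqrt_of_sq_le ?_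
  linarith [hgrowth x x.2]

lemma mem_iff_forall_exists_infDist_lt_and_forall_le (hd : DenseRange d)
    (hf : ContinuousOn f X) (hq : q ∈ X)
    (hgrowth : ∀ x ∈ X, f q + 1 / 2 * ‖x - q‖ ^ 2 ≤ f x) {F : Set E} (hF : IsClosed F)
    (hFne : F.Nonempty) :
    q ∈ F ↔ ∀ m : ℕ, ∃ k, Metric.infDist (d k : E) F < 1 / ((m : ℝ) + 1) ∧
      ∀ j, f (d k) ≤ f (d j) + 1 / ((m : ℝ) + 1) := by
  constructor
  · intro hqF m
    obtain ⟨k, hkq, hk⟩ := exists_dist_lt_and_lt_add_of_denseRange hd hf hq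
      (ε := 1 / ((m : ℝ) + 1)) (by positivity)
    refine ⟨k, (Metric.infDist_le_dist_of_mem hqF).trans_lt hkq, fun j => ?_⟩
    linarith [hgrowth (d j) (d j).2, sq_nonneg ‖(d j : E) - q‖]
  · intro hall
    rw [hF.mem_iff_infDist_zero hFne]
    refine le_antisymm ?_ Metric.infDist_nonneg
    have hε : Tendsto (fun m : ℕ => 1 / ((m : ℝ) + 1)) atTop (𝓝 0) :=
      tendsto_one_div_add_atTop_nhds_zero_nat
    have hlim : Tendsto (fun m : ℕ => 1 / ((m : ℝ) + 1) + √(2 * (1 / ((m : ℝ) + 1)))) atTop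
        (𝓝 0) := by
      simpa using hε.add (hε.const_mul 2).sqrt
    refine ge_of_tendsto' hlim fun m => ?_
    obtain ⟨k, hkF, hk⟩ := hall m
    calc Metric.infDist q F ≤ Metric.infDist (d k : E) F + dist q (d k) :=
          Metric.infDist_le_infDist_add_dist
      _ ≤ _ := by
        rw [dist_comm]
        exact add_le_add hkF.le (dist_le_sqrt_of_add_sq_le hd hf hq hgrowth hk)

end Minimizer

variable [MeasurableSpace E] [BorelSpace E]

lemma measurable_comp_of_continuousOn {f : E → ℝ} (hf : ContinuousOn f X) {v : Ω → E}
    (hv : Measurable v) (hvX : ∀ ω, v ω ∈ X) : Measurable fun ω => f (v ω) :=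
  (continuousOn_iff_continuous_domRestrict.1 hf).measurable.comp (hv.subtype_mk (h := hvX))

variable [SecondCountableTopology E]

lemma measurable_of_forall_add_sq_le {φ : Ω → E → ℝ}
    (hφm : ∀ x ∈ X, Measurable fun ω => φ ω x) (hφc : ∀ ω, ContinuousOn (φ ω) X) {q : Ω → E}
    (hq : ∀ ω, q ω ∈ X)
    (hgrowth : ∀ ω, ∀ x ∈ X, φ ω (q ω) + 1 / 2 * ‖x - q ω‖ ^ 2 ≤ φ ω x) : Measurable q := by
  rcases isEmpty_or_nonempty Ω with hΩ | ⟨⟨ω₀⟩⟩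
  · exact measurable_of_empty q
  have : Nonempty X := ⟨⟨q ω₀, hq ω₀⟩⟩
  obtain ⟨d, hd⟩ := TopologicalSpace.exists_dense_seq X
  refine measurable_of_isClosed' fun F hF hFne _ => ?_
  have hpre : q ⁻¹' F = ⋂ m : ℕ, ⋃ k : ℕ, {_ω | Metric.infDist (d k : E) F < 1 / ((m : ℝ) + 1)} ∩
      ⋂ j, {ω | φ ω (d k) ≤ φ ω (d j) + 1 / ((m : ℝ) + 1)} := by
    ext ω
    simp only [mem_preimage, mem_iInter, mem_iUnion, mem_inter_iff, mem_ofPred_eq]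
    exact mem_iff_forall_exists_infDist_lt_and_forall_le hd (hφc ω) (hq ω) (hgrowth ω) hF hFne
  rw [hpre]
  exact MeasurableSet.iInter fun m => MeasurableSet.iUnion fun k =>
    (MeasurableSet.const _).inter <| MeasurableSet.iInter fun j =>
      measurableSet_le (hφm _ (d k).2) ((hφm _ (d j).2).add_const _)

variable [NormedSpace ℝ E] {ψ : E → ℝ} {v : Ω → E}

lemma measurable_fderivWithin_apply_sub (hX : Convex ℝ X) (hψ : DifferentiableOn ℝ ψ X)
    (hv : Measurable v) (hvX : ∀ ω, v ω ∈ X) {x : E} (hx : x ∈ X) :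
    Measurable fun ω => fderivWithin ℝ ψ X (v ω) (x - v ω) := by
  have hinv : Tendsto (fun k : ℕ => (k : ℝ)⁻¹) atTop (𝓝[>] 0) :=
    tendsto_inv_atTop_nhdsGT_zero.comp tendsto_natCast_atTop_atTop
  refine measurable_of_tendsto_metrizable (fun k => ?_) <| tendsto_pi_nhds.2 fun ω =>
    (tendsto_slope_fderivWithin hX (hψ _ (hvX ω)) (hvX ω) hx).comp hinv
  have hmem (ω : Ω) : v ω + (k : ℝ)⁻¹ • (x - v ω) ∈ X :=
    hX.add_smul_sub_mem (hvX ω) hx ⟨by positivity, Nat.cast_inv_le_one k⟩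
  have hmeas : Measurable fun ω => v ω + (k : ℝ)⁻¹ • (x - v ω) :=
    hv.add ((measurable_const.sub hv).const_smul _)
  exact ((measurable_comp_of_continuousOn hψ.continuousOn hmeas hmem).sub
    (measurable_comp_of_continuousOn hψ.continuousOn hv hvX)).const_mul _

lemma IsRegularizer.measurable_bregman_right (h : IsRegularizer X ψ) (hv : Measurable v)
    (hvX : ∀ ω, v ω ∈ X) {x : E} (hx : x ∈ X) : Measurable fun ω => bregman X ψ x (v ω) :=
  (measurable_const.sub
    (measurable_comp_of_continuousOn h.differentiableOn.continuousOn hv hvX)).sub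
    (measurable_fderivWithin_apply_sub h.strongConvexOn.1 h.differentiableOn hv hvX hx)

lemma stronglyMeasurable_dual_apply {A : Ω → StrongDual ℝ E} (hA : StronglyMeasurable A)
    (hv : Measurable v) : StronglyMeasurable fun ω => A ω (v ω) :=
  isBoundedBilinearMap_apply.continuous.comp_stronglyMeasurable (hA.prodMk hv.stronglyMeasurable)

lemma IsRegularizer.measurable_prox (h : IsRegularizer X ψ) {q : Ω → E}
    {y : Ω → StrongDual ℝ E} (hv : Measurable v) (hvX : ∀ ω, v ω ∈ X)
    (hy : StronglyMeasurable y) (hq : ∀ ω, IsProx X ψ (v ω) (y ω) (q ω)) : Measurable q := by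
  refine measurable_of_forall_add_sq_le (X := X)
    (φ := fun ω x => y ω (v ω - x) + bregman X ψ x (v ω))
    (fun x hx => ?_) (fun ω => ?_) (fun ω => (hq ω).1) fun ω x hx => ?_
  · exact (stronglyMeasurable_dual_apply hy (hv.sub measurable_const)).measurable.add
      (h.measurable_bregman_right hv hvX hx)
  · exact ((y ω).continuous.comp (continuous_const.sub continuous_id)).continuousOn.add
      (h.continuousOn_bregman _)
  · have hconv : StrongConvexOn X 1 (fun x => y ω (v ω - x) + bregman X ψ x (v ω)) := by
      convert strongConvexOn_add_dual_add_const (h.strongConvexOn_bregman (v ω)) (-(y ω))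
        (y ω (v ω)) using 2 with x
      simp only [map_sub, neg_apply]
      ring
    exact add_sq_le_of_strongConvexOn_of_isMinOn hconv (hq ω).2 (hq ω).1 hx

end Measurability

section LinearDynamics

variable {E : Type*} [NormedAddCommGroup E] [NormedSpace ℝ E] {k m n : ℕ}

/-- The average `(1/n) ∑_i x_i` of the states of the agents of a network, which doubly stochastic
mixing preserves. -/
def mean (x : Fin n → E) : E := (n : ℝ)⁻¹ • ∑ i, x i

lemma mix_mem {X : Set E} (hX : Convex ℝ X) {w : Matrix (Fin m) (Fin n) ℝ} {x : Fin n → E}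
    {i : Fin m} (hw : ∀ j, 0 ≤ w i j) (hsum : ∑ j, w i j = 1) (hx : ∀ j, x j ∈ X) :
    mix w x i ∈ X :=
  hX.sum_mem (fun j _ => hw j) hsum fun j _ => hx j

lemma mean_mem {X : Set E} (hX : Convex ℝ X) (hn : 0 < n) {x : Fin n → E} (hx : ∀ j, x j ∈ X) :
    mean x ∈ X := by
  have hn' : (n : ℝ) ≠ 0 := by positivity
  rw [mean, Finset.smul_sum]
  exact hX.sum_mem (fun j _ => by positivity) (by simp [hn']) fun j _ => hx j

lemma norm_mix_sub_le {w : Matrix (Fin m) (Fin n) ℝ} {x : Fin n → E} {i : Fin m}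
    (hw : ∀ j, 0 ≤ w i j) (hsum : ∑ j, w i j = 1) (c : E) :
    ‖mix w x i - c‖ ≤ ∑ j, w i j * ‖x j - c‖ := by
  have hcentre : mix w x i - c = ∑ j, w i j • (x j - c) := by
    simp only [mix, smul_sub, Finset.sum_sub_distrib, ← Finset.sum_smul, hsum, one_smul]
  rw [hcentre]
  refine (norm_sum_le _ _).trans_eq (Finset.sum_congr rfl fun j _ => ?_)
  rw [norm_smul, Real.norm_of_nonneg (hw j)]

lemma norm_mix_sub_mean_le {w : Matrix (Fin m) (Fin n) ℝ} {x : Fin n → E} {i : Fin m} {c : ℝ}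
    (hw : ∀ j, |w i j - 1 / n| ≤ c) : ‖mix w x i - mean x‖ ≤ c * ∑ j, ‖x j‖ := by
  have hdiff : mix w x i - mean x = ∑ j, (w i j - 1 / n) • x j := by
    simp only [mix, mean, sub_smul, Finset.sum_sub_distrib, one_div, Finset.smul_sum]
  rw [hdiff, Finset.mul_sum]
  refine norm_sum_le_of_le _ fun j _ => ?_
  rw [norm_smul, Real.norm_eq_abs]
  exact mul_le_mul_of_nonneg_right (hw j) (norm_nonneg _)

lemma mix_add (w : Matrix (Fin m) (Fin n) ℝ) (x y : Fin n → E) (i : Fin m) :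
    mix w (fun j => x j + y j) i = mix w x i + mix w y i := by
  simp only [mix, smul_add, Finset.sum_add_distrib]

lemma mix_sum {ι : Type*} (s : Finset ι) (w : Matrix (Fin m) (Fin n) ℝ) (x : ι → Fin n → E)
    (i : Fin m) : mix w (fun j => ∑ a ∈ s, x a j) i = ∑ a ∈ s, mix w (x a) i := by
  simp only [mix, Finset.smul_sum]
  exact Finset.sum_comm

lemma mix_mix (v : Matrix (Fin k) (Fin m) ℝ) (w : Matrix (Fin m) (Fin n) ℝ) (x : Fin n → E)
    (i : Fin k) : mix v (fun j => mix w x j) i = mix (v * w) x i := by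
  simp only [mix, Matrix.mul_apply, Finset.sum_smul, Finset.smul_sum, smul_smul]
  exact Finset.sum_comm

lemma mix_one (x : Fin n → E) (i : Fin n) : mix 1 x i = x i := by
  simp only [mix, Matrix.one_apply, ite_smul, one_smul, zero_smul, Finset.sum_ite_eq,
    Finset.mem_univ, if_true]

lemma mean_add (x y : Fin n → E) : mean (fun i => x i + y i) = mean x + mean y := by
  simp only [mean, Finset.sum_add_distrib, smul_add]

lemma mean_mix {w : Matrix (Fin n) (Fin n) ℝ} (hcol : ∀ j, ∑ i, w i j = 1) (x : Fin n → E) :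
    mean (mix w x) = mean x := by
  unfold mean mix
  rw [Finset.sum_comm]
  simp only [← Finset.sum_smul, hcol, one_smul]

section PerturbedAveraging

variable {W : ℕ → Matrix (Fin n) (Fin n) ℝ} {x r : ℕ → Fin n → E}

lemma state_eq_transition (hx : ∀ t i, x (t + 1) i = mix (W t) (x t) i + r t i) (t : ℕ)
    (i : Fin n) :
    x t i = mix (transition W 0 t) (x 0) i +
      ∑ s ∈ Finset.range t, mix (transition W (s + 1) (t - 1 - s)) (r s) i := by
  induction t generalizing i with
  | zero => simp only [transition, mix_one, Finset.range_zero, Finset.sum_empty, add_zero]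
  | succ t ih =>
    rw [hx, funext ih, mix_add, mix_sum, mix_mix, Finset.sum_range_succ, ← add_assoc,
      Nat.add_sub_cancel, Nat.sub_self]
    congr 1
    · congr 1
      · rw [transition, zero_add]
      · refine Finset.sum_congr rfl fun s hs => ?_
        have hst : s < t := Finset.mem_range.1 hs
        rw [mix_mix, show t - s = (t - 1 - s) + 1 by omega, transition,
          show s + 1 + (t - 1 - s) = t by omega]
    · rw [transition, mix_one]

lemma mean_state_eq (hcol : ∀ t j, ∑ i, W t i j = 1)
    (hx : ∀ t i, x (t + 1) i = mix (W t) (x t) i + r t i) (t : ℕ) :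
    mean (x t) = mean (x 0) + ∑ s ∈ Finset.range t, mean (r s) := by
  induction t with
  | zero => rw [Finset.range_zero, Finset.sum_empty, add_zero]
  | succ t ih =>
    rw [Finset.sum_range_succ, ← add_assoc, ← ih, ← mean_mix (hcol t) (x t), ← mean_add,
      funext (hx t)]

lemma IsMixing.norm_state_sub_mean_le {η : ℝ} {B : ℕ} {G : ℕ → Digraph (Fin n)}
    (h : IsMixing η B G W) (hη : 0 < η) (hη1 : η < 1)
    (hx : ∀ t i, x (t + 1) i = mix (W t) (x t) i + r t i) (t : ℕ) (i : Fin n) :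
    ‖x t i - mean (x t)‖ ≤ Gam η n * theta η n B ^ t * ∑ j, ‖x 0 j‖ +
      ∑ s ∈ Finset.range t, Gam η n * theta η n B ^ (t - 1 - s) * ∑ j, ‖r s j‖ := by
  rw [state_eq_transition hx, mean_state_eq h.col_sum hx, add_sub_add_comm,
    ← Finset.sum_sub_distrib]
  refine norm_add_le_of_le ?_ (norm_sum_le_of_le _ fun s _ => ?_)
  · exact norm_mix_sub_mean_le (h.abs_transition_sub_le hη hη1 0 t i)
  · exact norm_mix_sub_mean_le (h.abs_transition_sub_le hη hη1 (s + 1) (t - 1 - s) i)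

end PerturbedAveraging

section Geometric

variable {α : ℕ → ℝ} {θ : ℝ}

lemma sum_mul_geometric_le (hα : Antitone α) (hα0 : 0 ≤ α 0) (hθ0 : 0 ≤ θ) (hθ1 : θ < 1)
    (T : ℕ) : ∑ t ∈ Finset.range T, α t * θ ^ t ≤ α 0 / (1 - θ) := by
  calc ∑ t ∈ Finset.range T, α t * θ ^ t ≤ ∑ t ∈ Finset.range T, α 0 * θ ^ t :=
        Finset.sum_le_sum fun t _ =>
          mul_le_mul_of_nonneg_right (hα (Nat.zero_le t)) (pow_nonneg hθ0 t)
    _ = α 0 * ∑ t ∈ Finset.range T, θ ^ t := (Finset.mul_sum _ _ _).symm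
    _ ≤ α 0 * (1 - θ)⁻¹ := by
        refine mul_le_mul_of_nonneg_left ?_ hα0
        rw [← tsum_geometric_of_lt_one hθ0 hθ1]
        exact (summable_geometric_of_lt_one hθ0 hθ1).sum_le_tsum _ fun t _ => pow_nonneg hθ0 t
    _ = α 0 / (1 - θ) := (div_eq_mul_inv _ _).symm

lemma sum_geometric_convolution_le {b : ℕ → ℝ} (hb : ∀ s, 0 ≤ b s) (hθ0 : 0 ≤ θ) (hθ1 : θ < 1)
    (T : ℕ) :
    ∑ t ∈ Finset.range T, ∑ s ∈ Finset.range t, θ ^ (t - 1 - s) * b s ≤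
      (∑ t ∈ Finset.range T, b t) / (1 - θ) := by
  set q : ℕ → ℝ := fun t => ∑ s ∈ Finset.range t, θ ^ (t - 1 - s) * b s with hq
  have q_nonneg (t : ℕ) : 0 ≤ q t :=
    Finset.sum_nonneg fun s _ => mul_nonneg (pow_nonneg hθ0 _) (hb s)
  have q_succ (t : ℕ) : q (t + 1) = θ * q t + b t := by
    simp only [hq]
    rw [Finset.sum_range_succ, Finset.mul_sum, Nat.add_sub_cancel, Nat.sub_self, pow_zero,
      one_mul]
    congr 1
    refine Finset.sum_congr rfl fun s hs => ?_
    have hst : s < t := Finset.mem_range.1 hs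
    rw [show t - s = (t - 1 - s) + 1 by omega, pow_succ']
    ring
  have balance (T : ℕ) :
      (1 - θ) * ∑ t ∈ Finset.range T, q t + q T = ∑ t ∈ Finset.range T, b t := by
    induction T with
    | zero => simp [hq]
    | succ T ih => rw [Finset.sum_range_succ, Finset.sum_range_succ, ← ih, q_succ]; ring
  rw [le_div_iff₀ (sub_pos.2 hθ1)]
  linarith [balance T, q_nonneg T]

lemma sum_mul_geometric_convolution_le (hα : Antitone α) (hα0 : ∀ t, 0 ≤ α t) (hθ0 : 0 ≤ θ)
    (hθ1 : θ < 1) (T : ℕ) :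
    ∑ t ∈ Finset.range T, α t * ∑ s ∈ Finset.range t, θ ^ (t - 1 - s) * α s ≤
      (∑ t ∈ Finset.range T, α t ^ 2) / (1 - θ) := by
  refine le_trans (Finset.sum_le_sum fun t _ => ?_)
    (sum_geometric_convolution_le (fun s => sq_nonneg (α s)) hθ0 hθ1 T)
  rw [Finset.mul_sum]
  refine Finset.sum_le_sum fun s hs => ?_
  calc α t * (θ ^ (t - 1 - s) * α s) ≤ α s * (θ ^ (t - 1 - s) * α s) :=
        mul_le_mul_of_nonneg_right (hα (Finset.mem_range.1 hs).le)
          (mul_nonneg (pow_nonneg hθ0 _) (hα0 s))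
    _ = θ ^ (t - 1 - s) * α s ^ 2 := by ring

end Geometric

end LinearDynamics

section Noise

variable {Ω E : Type*} {ℱ : MeasurableSpace Ω} [mΩ : MeasurableSpace Ω] [NormedAddCommGroup E]
  [NormedSpace ℝ E] {P : Measure Ω}

/-- The conditionally centered part `ghat - 𝔼[ghat | ℱ]` of a random functional, that is, the
error of the sampled subgradient `ghat`. -/
def noise (P : Measure Ω) (ℱ : MeasurableSpace Ω) (ghat : Ω → StrongDual ℝ E) :
    Ω → StrongDual ℝ E := fun ω => ghat ω - (P[ghat | ℱ]) ω

lemma integrable_noise {ghat : Ω → StrongDual ℝ E} (hg : Integrable ghat P) :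
    Integrable (noise P ℱ ghat) P :=
  hg.sub integrable_condExp

lemma condExp_noise [IsFiniteMeasure P] (hℱ : ℱ ≤ mΩ) {ghat : Ω → StrongDual ℝ E}
    (hg : Integrable ghat P) : P[noise P ℱ ghat | ℱ] =ᵐ[P] 0 := by
  have h : P[noise P ℱ ghat | ℱ] =ᵐ[P] P[ghat | ℱ] - P[P[ghat | ℱ] | ℱ] :=
    condExp_sub hg integrable_condExp ℱ
  rwa [condExp_of_stronglyMeasurable hℱ stronglyMeasurable_condExp integrable_condExp,
    sub_self] at h

lemma integrable_apply_of_bounded {e : Ω → StrongDual ℝ E} (he : Integrable e P) {u : Ω → E}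
    (hu : AEStronglyMeasurable u P) {C : ℝ} (hC : ∀ ω, ‖u ω‖ ≤ C) :
    Integrable (fun ω => e ω (u ω)) P :=
  (ContinuousLinearMap.apply ℝ ℝ : E →L[ℝ] (E →L[ℝ] ℝ) →L[ℝ] ℝ).integrable_of_bilin_of_bdd_left C
    hu (ae_of_all _ hC) he

lemma integral_apply_eq_zero_of_condExp_eq_zero [IsFiniteMeasure P] [CompleteSpace E]
    (hℱ : ℱ ≤ mΩ) {e : Ω → StrongDual ℝ E} (he : Integrable e P) (he0 : P[e | ℱ] =ᵐ[P] 0)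
    {u : Ω → E} (hu : StronglyMeasurable[ℱ] u) {C : ℝ} (hC : ∀ ω, ‖u ω‖ ≤ C) :
    ∫ ω, e ω (u ω) ∂P = 0 := by
  have hi := integrable_apply_of_bounded he (hu.mono hℱ).aestronglyMeasurable hC
  have hpull : P[fun ω => e ω (u ω) | ℱ] =ᵐ[P] fun ω => (P[e | ℱ]) ω (u ω) :=
    condExp_bilin_of_stronglyMeasurable_left (μ := P)
      (ContinuousLinearMap.apply ℝ ℝ : E →L[ℝ] (E →L[ℝ] ℝ) →L[ℝ] ℝ) hu hi he
  rw [← integral_condExp hℱ]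
  refine integral_eq_zero_of_ae ?_
  filter_upwards [hpull, he0] with ω h1 h2
  rw [h1, h2, Pi.zero_apply, zero_apply, Pi.zero_apply]

lemma integral_norm_le_of_integral_norm_sq_le [IsProbabilityMeasure P] {F : Type*}
    [NormedAddCommGroup F] {e : Ω → F} (he : MemLp e 2 P) {ν : ℝ} (hν : 0 ≤ ν)
    (h : ∫ ω, ‖e ω‖ ^ 2 ∂P ≤ ν ^ 2) : ∫ ω, ‖e ω‖ ∂P ≤ ν := by
  have hvar := variance_nonneg (fun ω => ‖e ω‖) P
  rw [variance_eq_sub he.norm, sub_nonneg] at hvar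
  exact le_of_sq_le_sq (hvar.trans h) hν

end Noise

section Sampling

variable {Ω E : Type*} {ℱ : MeasurableSpace Ω} [mΩ : MeasurableSpace Ω] [NormedAddCommGroup E]
  [NormedSpace ℝ E] {P : Measure Ω} {X : Set E} {h : Ω → E → ℝ} {v : Ω → E}
  {ghat : Ω → StrongDual ℝ E} {L ν : ℝ}

namespace UnbiasedBounded

lemma integrable (hb : UnbiasedBounded P ℱ X h v ghat L ν) : Integrable ghat P := by
  obtain ⟨g, -, hi, -⟩ := hb
  exact hi

lemma ae_isSubgradientOn (hb : UnbiasedBounded P ℱ X h v ghat L ν) :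
    ∀ᵐ ω ∂P, IsSubgradientOn X (h ω) (v ω) (ghat ω - noise P ℱ ghat ω) := by
  obtain ⟨g, hg, -, hge, -⟩ := hb
  filter_upwards [hg, hge] with ω hω hgω
  rw [noise, hgω, sub_sub_cancel]
  exact hω.1

lemma ae_norm_le (hb : UnbiasedBounded P ℱ X h v ghat L ν) :
    ∀ᵐ ω ∂P, ‖ghat ω‖ ≤ L + ‖noise P ℱ ghat ω‖ := by
  obtain ⟨g, hg, -, hge, -⟩ := hb
  filter_upwards [hg, hge] with ω hω hgω
  calc ‖ghat ω‖ = ‖g ω + noise P ℱ ghat ω‖ := by rw [noise, hgω, add_sub_cancel]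
    _ ≤ ‖g ω‖ + ‖noise P ℱ ghat ω‖ := norm_add_le _ _
    _ ≤ L + ‖noise P ℱ ghat ω‖ := by gcongr; exact hω.2

lemma memLp_noise (hb : UnbiasedBounded P ℱ X h v ghat L ν) : MemLp (noise P ℱ ghat) 2 P := by
  obtain ⟨g, -, hi, hge, hsq, -⟩ := hb
  refine (memLp_two_iff_integrable_sq_norm (integrable_noise hi).aestronglyMeasurable).2
    (hsq.congr ?_)
  filter_upwards [hge] with ω hgω
  rw [noise, hgω, norm_sub_rev]

lemma memLp_bound [IsFiniteMeasure P] (hb : UnbiasedBounded P ℱ X h v ghat L ν) :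
    MemLp (fun ω => L + ‖noise P ℱ ghat ω‖) 2 P :=
  (memLp_const L).add hb.memLp_noise.norm

lemma memLp [IsFiniteMeasure P] (hb : UnbiasedBounded P ℱ X h v ghat L ν) :
    MemLp ghat 2 P :=
  hb.memLp_bound.mono' hb.integrable.aestronglyMeasurable hb.ae_norm_le

variable [IsProbabilityMeasure P]

lemma bound_nonneg (hb : UnbiasedBounded P ℱ X h v ghat L ν) : 0 ≤ L := by
  obtain ⟨g, hg, -⟩ := hb
  obtain ⟨ω, hω⟩ := hg.exists
  exact (norm_nonneg _).trans hω.2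

lemma integral_noise_sq_le (hb : UnbiasedBounded P ℱ X h v ghat L ν) (hℱ : ℱ ≤ mΩ) :
    ∫ ω, ‖noise P ℱ ghat ω‖ ^ 2 ∂P ≤ ν ^ 2 := by
  obtain ⟨g, -, -, hge, -, hle⟩ := hb
  have hnoise : (fun ω => ‖noise P ℱ ghat ω‖ ^ 2) =ᵐ[P] fun ω => ‖g ω - ghat ω‖ ^ 2 := by
    filter_upwards [hge] with ω hgω
    rw [noise, hgω, norm_sub_rev]
  calc ∫ ω, ‖noise P ℱ ghat ω‖ ^ 2 ∂P
      = ∫ ω, (P[fun ω => ‖g ω - ghat ω‖ ^ 2 | ℱ]) ω ∂P := by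
        rw [integral_congr_ae hnoise, integral_condExp hℱ]
    _ ≤ ∫ _, ν ^ 2 ∂P := integral_mono_ae integrable_condExp (integrable_const _) hle
    _ = ν ^ 2 := by simp

lemma integral_norm_noise_le (hb : UnbiasedBounded P ℱ X h v ghat L ν) (hℱ : ℱ ≤ mΩ)
    (hν : 0 ≤ ν) : ∫ ω, ‖noise P ℱ ghat ω‖ ∂P ≤ ν :=
  integral_norm_le_of_integral_norm_sq_le hb.memLp_noise hν (hb.integral_noise_sq_le hℱ)

lemma integral_norm_le (hb : UnbiasedBounded P ℱ X h v ghat L ν) (hℱ : ℱ ≤ mΩ) (hν : 0 ≤ ν) :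
    ∫ ω, ‖ghat ω‖ ∂P ≤ L + ν := by
  have hnoise := (integrable_noise (P := P) (ℱ := ℱ) hb.integrable).norm
  calc ∫ ω, ‖ghat ω‖ ∂P ≤ ∫ ω, (L + ‖noise P ℱ ghat ω‖) ∂P :=
        integral_mono_ae hb.integrable.norm ((integrable_const _).add hnoise) hb.ae_norm_le
    _ = L + ∫ ω, ‖noise P ℱ ghat ω‖ ∂P := by
        rw [integral_add (integrable_const _) hnoise, integral_const, probReal_univ, one_smul]
    _ ≤ L + ν := by
        gcongr
        exact hb.integral_norm_noise_le hℱ hν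

lemma integral_norm_sq_le (hb : UnbiasedBounded P ℱ X h v ghat L ν) (hℱ : ℱ ≤ mΩ) (hν : 0 ≤ ν) :
    ∫ ω, ‖ghat ω‖ ^ 2 ∂P ≤ (L + ν) ^ 2 := by
  have hL := hb.bound_nonneg
  have hnoise := (integrable_noise (P := P) (ℱ := ℱ) hb.integrable).norm
  have hnoise_sq := hb.memLp_noise.integrable_norm_pow two_ne_zero
  calc ∫ ω, ‖ghat ω‖ ^ 2 ∂P ≤ ∫ ω, (L + ‖noise P ℱ ghat ω‖) ^ 2 ∂P := by
        refine integral_mono_ae (hb.memLp.integrable_norm_pow two_ne_zero)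
          hb.memLp_bound.integrable_sq ?_
        filter_upwards [hb.ae_norm_le] with ω hω
        exact pow_le_pow_left₀ (norm_nonneg _) hω 2
    _ = L ^ 2 + 2 * L * ∫ ω, ‖noise P ℱ ghat ω‖ ∂P + ∫ ω, ‖noise P ℱ ghat ω‖ ^ 2 ∂P := by
        simp only [add_sq]
        rw [integral_add (f := fun ω => L ^ 2 + 2 * L * ‖noise P ℱ ghat ω‖)
            ((integrable_const _).add (hnoise.const_mul _)) hnoise_sq,
          integral_add (integrable_const _) (hnoise.const_mul _), integral_const_mul,
          integral_const, probReal_univ, one_smul]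
    _ ≤ L ^ 2 + 2 * L * ν + ν ^ 2 := by
        gcongr
        exacts [hb.integral_norm_noise_le hℱ hν, hb.integral_noise_sq_le hℱ]
    _ = (L + ν) ^ 2 := (add_sq L ν).symm

end UnbiasedBounded

end Sampling

section GhostIterate

variable {Ω E : Type*} [mΩ : MeasurableSpace Ω] [NormedAddCommGroup E] [NormedSpace ℝ E]
  {X : Set E} {ψ : E → ℝ} {e : ℕ → Ω → StrongDual ℝ E} {v : ℕ → Ω → E}

lemma exists_stronglyMeasurable_regret_le (ℱ : Filtration ℕ mΩ) (hX : IsCompact X)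
    (hne : X.Nonempty) (hψ : IsRegularizer X ψ)
    (hem : ∀ t, StronglyMeasurable[ℱ (t + 1)] (e t)) :
    ∃ w : ℕ → Ω → E, (∀ t, StronglyMeasurable[ℱ t] (w t)) ∧ (∀ t ω, w t ω ∈ X) ∧
      ∀ T ω, ∀ z ∈ X, ∑ t ∈ Finset.range T, e t ω (z - w t ω) ≤
        bregmanDiamSq X ψ + ∑ t ∈ Finset.range T, 1 / 2 * ‖e t ω‖ ^ 2 := by
  obtain ⟨p, hp⟩ := hne
  obtain ⟨π, hπ⟩ := exists_isMirrorMap hX ⟨p, hp⟩ (hψ.continuousOn_bregman p)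
  have hconv := hψ.strongConvexOn_bregman p
  refine ⟨fun t ω => π (∑ s ∈ Finset.range t, e s ω), fun t => ?_, fun t ω => (hπ _).1,
    fun T ω z hz => ?_⟩
  · exact (hπ.lipschitzWith hconv).continuous.comp_stronglyMeasurable <|
      Finset.stronglyMeasurable_fun_sum _ fun s hs =>
        (hem s).mono (ℱ.mono (Finset.mem_range.1 hs))
  · have hregret := hπ.regret_le hconv (fun x hx => hψ.bregman_nonneg hx hp)
      (fun t => e t ω) T hz
    linarith [hψ.bregman_le hz hp]

variable [CompleteSpace E] {P : Measure Ω} [IsProbabilityMeasure P]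

-- The comparison point `z` may depend on `ω`, so the sum is not a martingale transform. It is
-- split at the regret minimizing iterate `w t`, which is known at time `t`.
lemma exists_integrable_sum_apply_sub_le (ℱ : Filtration ℕ mΩ) (hX : IsCompact X)
    (hψ : IsRegularizer X ψ) (hem : ∀ t, StronglyMeasurable[ℱ (t + 1)] (e t))
    (hL2 : ∀ t, MemLp (e t) 2 P) (he0 : ∀ t, P[e t | ℱ t] =ᵐ[P] 0)
    (hvm : ∀ t, StronglyMeasurable[ℱ t] (v t)) (hvX : ∀ t ω, v t ω ∈ X) (T : ℕ) :
    ∃ Φ : Ω → ℝ, Integrable Φ P ∧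
      (∀ ω, ∀ z ∈ X, ∑ t ∈ Finset.range T, e t ω (z - v t ω) ≤ Φ ω) ∧
      ∫ ω, Φ ω ∂P ≤
        bregmanDiamSq X ψ + ∑ t ∈ Finset.range T, 1 / 2 * ∫ ω, ‖e t ω‖ ^ 2 ∂P := by
  obtain ⟨ω₀⟩ := nonempty_of_isProbabilityMeasure P
  obtain ⟨C, hC⟩ := hX.isBounded.exists_norm_le
  obtain ⟨w, hwm, hwX, hregret⟩ :=
    exists_stronglyMeasurable_regret_le ℱ hX ⟨_, hvX 0 ω₀⟩ hψ hem
  have hbdd (t : ℕ) (ω : Ω) : ‖w t ω - v t ω‖ ≤ C + C :=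
    (norm_sub_le _ _).trans (add_le_add (hC _ (hwX t ω)) (hC _ (hvX t ω)))
  have he (t : ℕ) : Integrable (e t) P := (hL2 t).integrable one_le_two
  have hsq (t : ℕ) : Integrable (fun ω => 1 / 2 * ‖e t ω‖ ^ 2) P :=
    ((hL2 t).integrable_norm_pow two_ne_zero).const_mul _
  have happ (t : ℕ) : Integrable (fun ω => e t ω (w t ω - v t ω)) P :=
    integrable_apply_of_bounded (he t)
      (((hwm t).sub (hvm t)).mono (ℱ.le t)).aestronglyMeasurable (hbdd t)
  have hmart (t : ℕ) : ∫ ω, e t ω (w t ω - v t ω) ∂P = 0 :=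
    integral_apply_eq_zero_of_condExp_eq_zero (ℱ.le t) (he t) (he0 t) ((hwm t).sub (hvm t))
      (hbdd t)
  have hterm (t : ℕ) :
      Integrable (fun ω => 1 / 2 * ‖e t ω‖ ^ 2 + e t ω (w t ω - v t ω)) P :=
    (hsq t).add (happ t)
  have hsum := integrable_finsetSum (Finset.range T) fun t _ => hterm t
  refine ⟨fun ω => bregmanDiamSq X ψ +
    ∑ t ∈ Finset.range T, (1 / 2 * ‖e t ω‖ ^ 2 + e t ω (w t ω - v t ω)),
    (integrable_const _).add hsum, fun ω z hz => ?_, le_of_eq ?_⟩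
  · have := hregret T ω z hz
    simp only [map_sub, Finset.sum_add_distrib, Finset.sum_sub_distrib] at this ⊢
    linarith
  · rw [integral_add (integrable_const _) hsum, integral_const, probReal_univ, one_smul,
      integral_finsetSum _ fun t _ => hterm t]
    simp only [integral_add (hsq _) (happ _), hmart, add_zero, integral_const_mul]

end GhostIterate

section AverageBounds

variable {E : Type*} {m n : ℕ}

/-- The average over the agents of the regrets of their points `v k` against the common point
`z`, for the objectives `h k`. -/
def avgRegret (h : Fin n → E → ℝ) (v : Fin n → E) (z : E) : ℝ :=
  (1 / (n : ℝ)) * ∑ k, (h k (v k) - h k z)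

/-- The average over the receiving agents of their weighted averages of the real quantities `D`. -/
def avgMix (w : Matrix (Fin m) (Fin n) ℝ) (D : Fin n → ℝ) : ℝ :=
  (1 / (m : ℝ)) * ∑ k, ∑ j, w k j * D j

lemma avg_norm_mix_sub_le_avgMix [NormedAddCommGroup E] [NormedSpace ℝ E]
    {w : Matrix (Fin m) (Fin n) ℝ} (hw : ∀ k j, 0 ≤ w k j) (hsum : ∀ k, ∑ j, w k j = 1)
    (x : Fin n → E) (c : E) :
    (1 / (m : ℝ)) * ∑ k, ‖mix w x k - c‖ ≤ avgMix w fun j => ‖x j - c‖ :=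
  mul_le_mul_of_nonneg_left (Finset.sum_le_sum fun k _ => norm_mix_sub_le (hw k) (hsum k) c)
    (by positivity)

/-- The price of the disagreement of one network: `D j` is the distance of agent `j` from the
mean, `w` are the weights inside the network and `v` the weights given to it by the other one, and
`i` is the agent whose state is evaluated. -/
def consensusCost (w : Matrix (Fin n) (Fin n) ℝ) (v : Matrix (Fin m) (Fin n) ℝ) (D : Fin n → ℝ)
    (i : Fin n) : ℝ :=
  D i + avgMix w D + 2 * avgMix v D

variable {Ω : Type*} [MeasurableSpace Ω] {P : Measure Ω} {D : Fin n → Ω → ℝ} {K : ℝ}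

lemma integrable_avgMix (w : Matrix (Fin m) (Fin n) ℝ) (hD : ∀ j, Integrable (D j) P) :
    Integrable (fun ω => avgMix w fun j => D j ω) P :=
  (integrable_finsetSum _ fun _ _ => integrable_finsetSum _ fun j _ =>
    (hD j).const_mul _).const_mul _

lemma integral_avgMix (w : Matrix (Fin m) (Fin n) ℝ) (hD : ∀ j, Integrable (D j) P) :
    ∫ ω, avgMix w (fun j => D j ω) ∂P = avgMix w fun j => ∫ ω, D j ω ∂P := by
  have hrow (k : Fin m) : Integrable (fun ω => ∑ j, w k j * D j ω) P :=
    integrable_finsetSum _ fun j _ => (hD j).const_mul _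
  simp only [avgMix, integral_const_mul, integral_finsetSum _ fun k _ => hrow k,
    integral_finsetSum _ fun j _ => (hD j).const_mul (w _ j)]

lemma avgMix_le (hm : 0 < m) {w : Matrix (Fin m) (Fin n) ℝ} (hw : ∀ k j, 0 ≤ w k j)
    (hsum : ∀ k, ∑ j, w k j = 1) {D : Fin n → ℝ} (hD : ∀ j, D j ≤ K) : avgMix w D ≤ K := by
  have hm' : (0 : ℝ) < m := by exact_mod_cast hm
  rw [avgMix, one_div, inv_mul_le_iff₀ hm']
  calc ∑ k, ∑ j, w k j * D j ≤ ∑ k, ∑ j, w k j * K :=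
        Finset.sum_le_sum fun k _ => Finset.sum_le_sum fun j _ =>
          mul_le_mul_of_nonneg_left (hD j) (hw k j)
    _ = m * K := by simp only [← Finset.sum_mul, hsum, Finset.sum_const, Finset.card_univ,
        Fintype.card_fin, nsmul_eq_mul, mul_one]

lemma integrable_consensusCost (w : Matrix (Fin n) (Fin n) ℝ) (v : Matrix (Fin m) (Fin n) ℝ)
    (hD : ∀ j, Integrable (D j) P) (i : Fin n) :
    Integrable (fun ω => consensusCost w v (fun j => D j ω) i) P :=
  ((hD i).add (integrable_avgMix w hD)).add ((integrable_avgMix v hD).const_mul 2)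

lemma integral_consensusCost_le (hm : 0 < m) {w : Matrix (Fin n) (Fin n) ℝ}
    {v : Matrix (Fin m) (Fin n) ℝ} (hw : ∀ k j, 0 ≤ w k j) (hwsum : ∀ k, ∑ j, w k j = 1)
    (hv : ∀ k j, 0 ≤ v k j) (hvsum : ∀ k, ∑ j, v k j = 1) (hD : ∀ j, Integrable (D j) P)
    (hK : ∀ j, ∫ ω, D j ω ∂P ≤ K) (i : Fin n) :
    ∫ ω, consensusCost w v (fun j => D j ω) i ∂P ≤ 4 * K := by
  have hadd : Integrable (fun ω => D i ω + avgMix w fun j => D j ω) P :=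
    (hD i).add (integrable_avgMix w hD)
  have hw4 := avgMix_le i.pos hw hwsum hK
  have hv4 := avgMix_le hm hv hvsum hK
  simp only [consensusCost]
  rw [integral_add hadd ((integrable_avgMix v hD).const_mul 2),
    integral_add (hD i) (integrable_avgMix w hD), integral_const_mul, integral_avgMix w hD,
    integral_avgMix v hD]
  linarith [hK i]

/-- The bound `G θᵗ a + ∑_{s < t} G θ^{t-1-s} α(s) b(s)` on the distance from the mean of states
that start with size `a`, contract at rate `θ` and undergo perturbations of size `α(s) b(s)`. -/
def consensusBound (G θ : ℝ) (α : ℕ → ℝ) (a : ℝ) (b : ℕ → ℝ) (t : ℕ) : ℝ :=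
  G * θ ^ t * a + ∑ s ∈ Finset.range t, G * θ ^ (t - 1 - s) * (α s * b s)

variable {G θ : ℝ} {α : ℕ → ℝ}

lemma consensusBound_mono (hG : 0 ≤ G) (hθ : 0 ≤ θ) (hα : ∀ t, 0 ≤ α t) {a a' : ℝ}
    {b b' : ℕ → ℝ} (ha : a ≤ a') (hb : ∀ s, b s ≤ b' s) (t : ℕ) :
    consensusBound G θ α a b t ≤ consensusBound G θ α a' b' t := by
  unfold consensusBound
  gcongr with s
  exacts [hα s, hb s]

lemma integrable_consensusBound {a : Ω → ℝ} {b : ℕ → Ω → ℝ} (ha : Integrable a P)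
    (hb : ∀ s, Integrable (b s) P) (t : ℕ) :
    Integrable (fun ω => consensusBound G θ α (a ω) (fun s => b s ω) t) P :=
  (ha.const_mul _).add (integrable_finsetSum _ fun s _ => ((hb s).const_mul _).const_mul _)

lemma integral_consensusBound {a : Ω → ℝ} {b : ℕ → Ω → ℝ} (ha : Integrable a P)
    (hb : ∀ s, Integrable (b s) P) (t : ℕ) :
    ∫ ω, consensusBound G θ α (a ω) (fun s => b s ω) t ∂P =
      consensusBound G θ α (∫ ω, a ω ∂P) (fun s => ∫ ω, b s ω ∂P) t := by
  have hterm (s : ℕ) : Integrable (fun ω => G * θ ^ (t - 1 - s) * (α s * b s ω)) P :=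
    ((hb s).const_mul _).const_mul _
  simp only [consensusBound]
  rw [integral_add (ha.const_mul _) (integrable_finsetSum _ fun s _ => hterm s),
    integral_finsetSum _ fun s _ => hterm s]
  simp only [integral_const_mul]

lemma sum_mul_consensusBound_le (hα : Antitone α) (hα0 : ∀ t, 0 ≤ α t) (hG : 0 ≤ G)
    (hθ0 : 0 ≤ θ) (hθ1 : θ < 1) {a b : ℝ} (ha : 0 ≤ a) (hb : 0 ≤ b) (T : ℕ) :
    ∑ t ∈ Finset.range T, α t * consensusBound G θ α a (fun _ => b) t ≤
      G * a * (α 0 / (1 - θ)) + G * b * ((∑ t ∈ Finset.range T, α t ^ 2) / (1 - θ)) := by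
  calc ∑ t ∈ Finset.range T, α t * consensusBound G θ α a (fun _ => b) t
      = G * a * ∑ t ∈ Finset.range T, α t * θ ^ t +
          G * b * ∑ t ∈ Finset.range T, α t * ∑ s ∈ Finset.range t, θ ^ (t - 1 - s) * α s := by
        simp only [consensusBound, mul_add, Finset.sum_add_distrib, Finset.mul_sum]
        refine congrArg₂ (· + ·) (Finset.sum_congr rfl fun t _ => by ring)
          (Finset.sum_congr rfl fun t _ => Finset.sum_congr rfl fun s _ => by ring)
    _ ≤ _ := by
        gcongr
        exacts [sum_mul_geometric_le hα (hα0 0) hθ0 hθ1 T,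
          sum_mul_geometric_convolution_le hα hα0 hθ0 hθ1 T]

end AverageBounds

section OneNetwork

variable {Ω E : Type*} [mΩ : MeasurableSpace Ω] [NormedAddCommGroup E] [NormedSpace ℝ E]
  [MeasurableSpace E] {n : ℕ}

/-- Distributed stochastic mirror descent within one network of `n` agents: at time `t` agent `i`
receives an unbiased estimate `g t i` of a subgradient of its current objective `h t i`. The
influence of the other network is hidden in the dependence of `h t i` on the sample point. -/
structure IsMirrorDescent (P : Measure Ω) (ℱ : Filtration ℕ mΩ) (X : Set E) (ψ : E → ℝ)
    (α : ℕ → ℝ) (η : ℝ) (B : ℕ) (G : ℕ → Digraph (Fin n)) (W : ℕ → Matrix (Fin n) (Fin n) ℝ)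
    (L ν : ℝ) (h : ℕ → Fin n → Ω → E → ℝ) (x : ℕ → Fin n → Ω → E)
    (g : ℕ → Fin n → Ω → StrongDual ℝ E) : Prop where
  isCompact : IsCompact X
  isRegularizer : IsRegularizer X ψ
  convexOn_right : ∀ x ∈ X, ConvexOn ℝ X (fun y => bregman X ψ x y)
  isMixing : IsMixing η B G W
  η_pos : 0 < η
  η_lt_one : η < 1
  antitone : Antitone α
  nonneg : ∀ t, 0 ≤ α t
  ν_nonneg : 0 ≤ ν
  measurable_init : ∀ i, Measurable[ℱ 0] (x 0 i)
  init_mem : ∀ i ω, x 0 i ω ∈ X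
  measurable_subgradient : ∀ t i, StronglyMeasurable[ℱ (t + 1)] (g t i)
  step : ∀ t i ω, IsProx X ψ (mix (W t) (fun k => x t k ω) i) (-(α t • g t i ω)) (x (t + 1) i ω)
  sampling : ∀ t i, UnbiasedBounded P (ℱ t) X (h t i)
    (fun ω => mix (W t) (fun k => x t k ω) i) (g t i) L ν

namespace IsMirrorDescent

variable {P : Measure Ω} {ℱ : Filtration ℕ mΩ} {X : Set E} {ψ : E → ℝ} {α : ℕ → ℝ} {η : ℝ}
  {B : ℕ} {G : ℕ → Digraph (Fin n)} {W : ℕ → Matrix (Fin n) (Fin n) ℝ} {L ν : ℝ}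
  {h : ℕ → Fin n → Ω → E → ℝ} {x : ℕ → Fin n → Ω → E} {g : ℕ → Fin n → Ω → StrongDual ℝ E}

lemma state_mem (H : IsMirrorDescent P ℱ X ψ α η B G W L ν h x g) (t : ℕ) (i : Fin n) (ω : Ω) :
    x t i ω ∈ X := by
  cases t with
  | zero => exact H.init_mem i ω
  | succ t => exact (H.step t i ω).1

lemma mix_state_mem (H : IsMirrorDescent P ℱ X ψ α η B G W L ν h x g) (t : ℕ) (i : Fin n)
    (ω : Ω) : mix (W t) (fun k => x t k ω) i ∈ X :=
  mix_mem H.isRegularizer.strongConvexOn.1 (H.isMixing.weight_nonneg H.η_pos t i)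
    (H.isMixing.row_sum t i) fun k => H.state_mem t k ω

section Pathwise

variable {z : E}

lemma sum_bregman_mix_le (H : IsMirrorDescent P ℱ X ψ α η B G W L ν h x g) (hz : z ∈ X)
    (t : ℕ) (ω : Ω) :
    ∑ k, bregman X ψ z (mix (W t) (fun a => x t a ω) k) ≤ ∑ k, bregman X ψ z (x t k ω) := by
  calc ∑ k, bregman X ψ z (mix (W t) (fun a => x t a ω) k)
      ≤ ∑ k, ∑ a, W t k a * bregman X ψ z (x t a ω) :=
        Finset.sum_le_sum fun k _ => (H.convexOn_right z hz).map_sum_le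
          (fun a _ => H.isMixing.weight_nonneg H.η_pos t k a) (H.isMixing.row_sum t k)
          fun a _ => H.state_mem t a ω
    _ = ∑ k, bregman X ψ z (x t k ω) := by
        rw [Finset.sum_comm]
        simp only [← Finset.sum_mul, H.isMixing.col_sum, one_mul]

lemma sum_bregman_mix_sub_bregman_state_le (H : IsMirrorDescent P ℱ X ψ α η B G W L ν h x g)
    (hz : z ∈ X) (T : ℕ) (ω : Ω) :
    ∑ t ∈ Finset.range T, ∑ k, (bregman X ψ z (mix (W t) (fun a => x t a ω) k) -
      bregman X ψ z (x (t + 1) k ω)) ≤ n * bregmanDiamSq X ψ := by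
  calc ∑ t ∈ Finset.range T, ∑ k, (bregman X ψ z (mix (W t) (fun a => x t a ω) k) -
        bregman X ψ z (x (t + 1) k ω))
      ≤ ∑ t ∈ Finset.range T,
          (∑ k, bregman X ψ z (x t k ω) - ∑ k, bregman X ψ z (x (t + 1) k ω)) := by
        refine Finset.sum_le_sum fun t _ => ?_
        rw [Finset.sum_sub_distrib]
        exact sub_le_sub_right (H.sum_bregman_mix_le hz t ω) _
    _ = ∑ k, bregman X ψ z (x 0 k ω) - ∑ k, bregman X ψ z (x T k ω) :=
        Finset.sum_range_sub' (fun t => ∑ k, bregman X ψ z (x t k ω)) T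
    _ ≤ ∑ _k : Fin n, bregmanDiamSq X ψ - 0 := sub_le_sub
        (Finset.sum_le_sum fun k _ => H.isRegularizer.bregman_le hz (H.state_mem 0 k ω))
        (Finset.sum_nonneg fun k _ => H.isRegularizer.bregman_nonneg hz (H.state_mem T k ω))
    _ = n * bregmanDiamSq X ψ := by
        rw [sub_zero, Finset.sum_const, Finset.card_univ, Fintype.card_fin, nsmul_eq_mul]

lemma mul_regret_le (H : IsMirrorDescent P ℱ X ψ α η B G W L ν h x g) (hz : z ∈ X) {t : ℕ}
    {k : Fin n} {ω : Ω} (hsub : IsSubgradientOn X (h t k ω) (mix (W t) (fun a => x t a ω) k)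
      (g t k ω - noise P (ℱ t) (g t k) ω)) :
    α t * (h t k ω (mix (W t) (fun a => x t a ω) k) - h t k ω z) ≤
      (bregman X ψ z (mix (W t) (fun a => x t a ω) k) - bregman X ψ z (x (t + 1) k ω)) +
        (1 / 2 * ‖α t • g t k ω‖ ^ 2 + (α t • noise P (ℱ t) (g t k) ω)
          (z - mix (W t) (fun a => x t a ω) k)) := by
  have hdescent := H.isRegularizer.prox_descent (H.mix_state_mem t k ω) (H.step t k ω) hz
  have hlin := mul_le_mul_of_nonneg_left (hsub z hz) (H.nonneg t)
  rw [norm_neg] at hdescent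
  simp only [neg_apply, smul_apply, sub_apply, smul_eq_mul] at hdescent hlin ⊢
  linarith

lemma sum_avgRegret_le (H : IsMirrorDescent P ℱ X ψ α η B G W L ν h x g) (hn : 0 < n) {T : ℕ}
    {ω : Ω} (hsub : ∀ t k, IsSubgradientOn X (h t k ω) (mix (W t) (fun a => x t a ω) k)
      (g t k ω - noise P (ℱ t) (g t k) ω)) (hz : z ∈ X) {Ψ : Fin n → ℝ}
    (hΨ : ∀ k, ∑ t ∈ Finset.range T, (1 / 2 * ‖α t • g t k ω‖ ^ 2 +
      (α t • noise P (ℱ t) (g t k) ω) (z - mix (W t) (fun a => x t a ω) k)) ≤ Ψ k) :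
    ∑ t ∈ Finset.range T,
        α t * avgRegret (fun k => h t k ω) (mix (W t) fun a => x t a ω) z ≤
      bregmanDiamSq X ψ + (1 / (n : ℝ)) * ∑ k, Ψ k := by
  have hn' : (n : ℝ) ≠ 0 := Nat.cast_ne_zero.2 hn.ne'
  have total : ∑ t ∈ Finset.range T, ∑ k,
      α t * (h t k ω (mix (W t) (fun a => x t a ω) k) - h t k ω z) ≤
        n * bregmanDiamSq X ψ + ∑ k, Ψ k := by
    refine (Finset.sum_le_sum fun t _ => Finset.sum_le_sum fun k _ =>
      H.mul_regret_le hz (hsub t k)).trans ?_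
    simp only [Finset.sum_add_distrib (s := Finset.univ)]
    rw [Finset.sum_add_distrib]
    refine add_le_add (H.sum_bregman_mix_sub_bregman_state_le hz T ω) ?_
    simp only [← Finset.sum_add_distrib (s := Finset.univ)]
    rw [Finset.sum_comm]
    exact Finset.sum_le_sum fun k _ => hΨ k
  simp only [avgRegret, mul_left_comm _ (1 / (n : ℝ)), Finset.mul_sum (s := Finset.univ)] at total ⊢
  calc _ = (1 / (n : ℝ)) * ∑ t ∈ Finset.range T, ∑ k,
        α t * (h t k ω (mix (W t) (fun a => x t a ω) k) - h t k ω z) := by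
        simp only [Finset.mul_sum]
    _ ≤ (1 / (n : ℝ)) * (n * bregmanDiamSq X ψ + ∑ k, Ψ k) := by gcongr
    _ = _ := by rw [← Finset.mul_sum, mul_add, one_div, inv_mul_cancel_left₀ hn']

lemma norm_state_sub_mean_le (H : IsMirrorDescent P ℱ X ψ α η B G W L ν h x g) (t : ℕ)
    (i : Fin n) (ω : Ω) :
    ‖x t i ω - mean (fun k => x t k ω)‖ ≤
      consensusBound (Gam η n) (theta η n B) α (∑ j, ‖x 0 j ω‖) (fun s => ∑ j, ‖g s j ω‖) t := by
  have hG := (Gam_pos (n := n) H.η_lt_one).le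
  have hθ := (theta_pos (n := n) (B := B) H.η_lt_one).le
  refine (H.isMixing.norm_state_sub_mean_le H.η_pos H.η_lt_one (x := fun t k => x t k ω)
    (r := fun t k => x (t + 1) k ω - mix (W t) (fun a => x t a ω) k)
    (fun t k => (add_sub_cancel _ _).symm) t i).trans ?_
  unfold consensusBound
  gcongr with s
  rw [Finset.mul_sum]
  refine Finset.sum_le_sum fun j _ => ?_
  calc ‖x (s + 1) j ω - mix (W s) (fun a => x s a ω) j‖ ≤ ‖-(α s • g s j ω)‖ :=
        H.isRegularizer.norm_prox_sub_le (H.mix_state_mem s j ω) (H.step s j ω)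
    _ = α s * ‖g s j ω‖ := by rw [norm_neg, norm_smul, Real.norm_of_nonneg (H.nonneg s)]

end Pathwise

section Measurability

variable [BorelSpace E] [SecondCountableTopology E]

lemma measurable_state (H : IsMirrorDescent P ℱ X ψ α η B G W L ν h x g) (t : ℕ) (i : Fin n) :
    Measurable[ℱ t] (x t i) := by
  induction t generalizing i with
  | zero => exact H.measurable_init i
  | succ t ih =>
    have hmix : Measurable[ℱ t] fun ω => mix (W t) (fun k => x t k ω) i :=
      Finset.measurable_fun_sum _ fun k _ => (ih k).const_smul _
    exact H.isRegularizer.measurable_prox (m := ℱ (t + 1))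
      (hmix.mono (ℱ.mono t.le_succ) le_rfl) (H.mix_state_mem t i)
      ((H.measurable_subgradient t i).const_smul (α t)).neg (H.step t i)

lemma measurable_mix_state (H : IsMirrorDescent P ℱ X ψ α η B G W L ν h x g) (t : ℕ)
    (i : Fin n) : Measurable[ℱ t] fun ω => mix (W t) (fun k => x t k ω) i :=
  Finset.measurable_fun_sum _ fun k _ => (H.measurable_state t k).const_smul _

lemma measurable_norm_state_sub_mean (H : IsMirrorDescent P ℱ X ψ α η B G W L ν h x g) (t : ℕ)
    (i : Fin n) : Measurable fun ω => ‖x t i ω - mean (fun k => x t k ω)‖ := by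
  have hx (k : Fin n) : Measurable (x t k) := (H.measurable_state t k).mono (ℱ.le t) le_rfl
  exact ((hx i).sub ((Finset.measurable_fun_sum _ fun k _ => hx k).const_smul _)).norm

end Measurability

section Init

variable [BorelSpace E] [IsProbabilityMeasure P]

lemma integrable_norm_init (H : IsMirrorDescent P ℱ X ψ α η B G W L ν h x g) (i : Fin n) :
    Integrable (fun ω => ‖x 0 i ω‖) P := by
  obtain ⟨C, hC⟩ := H.isCompact.isBounded.exists_norm_le
  refine Integrable.of_bound ((H.measurable_init i).mono (ℱ.le 0) le_rfl).norm.aestronglyMeasurable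
    C (ae_of_all _ fun ω => ?_)
  rw [norm_norm]
  exact hC _ (H.state_mem 0 i ω)

lemma integral_norm_init_le (H : IsMirrorDescent P ℱ X ψ α η B G W L ν h x g) (i : Fin n) :
    ∫ ω, ‖x 0 i ω‖ ∂P ≤ ∫ ω, (⨆ k, ‖x 0 k ω‖) ∂P := by
  obtain ⟨C, hC⟩ := H.isCompact.isBounded.exists_norm_le
  have : Nonempty (Fin n) := ⟨i⟩
  have hmeas : Measurable fun ω => ⨆ k, ‖x 0 k ω‖ :=
    Measurable.iSup fun k => ((H.measurable_init k).mono (ℱ.le 0) le_rfl).norm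
  have hsup : Integrable (fun ω => ⨆ k, ‖x 0 k ω‖) P := by
    refine Integrable.of_bound hmeas.aestronglyMeasurable C (ae_of_all _ fun ω => ?_)
    rw [Real.norm_of_nonneg (Real.iSup_nonneg fun k => norm_nonneg _)]
    exact ciSup_le fun k => hC _ (H.state_mem 0 k ω)
  exact integral_mono (H.integrable_norm_init i) hsup fun ω =>
    le_ciSup (f := fun k => ‖x 0 k ω‖) (finite_range _).bddAbove i

end Init

end IsMirrorDescent

end OneNetwork

lemma regret_add_consensus_bound_le {L ν η Λ a R S : ℝ} {n B : ℕ} (hL : 0 ≤ L) (hν : 0 ≤ ν)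
    (hS : 0 ≤ S) :
    2 * R + (1 / 2 * (L + ν) ^ 2 + 1 / 2 * ν ^ 2) * S +
      L * (4 * (Gam η n * (n * Λ) * (a / (1 - theta η n B)) +
        Gam η n * (n * (L + ν)) * (S / (1 - theta η n B)))) ≤
    constM₁ L η n B Λ a R + constM₂ L ν η n B * S := by
  have slack : 0 ≤ (8 * L * (L + ν) + 1 / 2 * (L + ν) ^ 2) * S := by positivity
  refine le_of_sub_nonneg (slack.trans_eq ?_)
  rw [constM₁, constM₂]
  ring

section OneNetworkExpectation

variable {Ω E : Type*} [mΩ : MeasurableSpace Ω] [NormedAddCommGroup E] [NormedSpace ℝ E]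
  [MeasurableSpace E] [BorelSpace E] [SecondCountableTopology E] {n : ℕ}

namespace IsMirrorDescent

variable {P : Measure Ω} [IsProbabilityMeasure P] {ℱ : Filtration ℕ mΩ} {X : Set E} {ψ : E → ℝ}
  {α : ℕ → ℝ} {η : ℝ} {B : ℕ} {G : ℕ → Digraph (Fin n)} {W : ℕ → Matrix (Fin n) (Fin n) ℝ}
  {L ν : ℝ} {h : ℕ → Fin n → Ω → E → ℝ} {x : ℕ → Fin n → Ω → E}
  {g : ℕ → Fin n → Ω → StrongDual ℝ E}

section Consensus

lemma integrable_norm_state_sub_mean (H : IsMirrorDescent P ℱ X ψ α η B G W L ν h x g) (t : ℕ)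
    (i : Fin n) : Integrable (fun ω => ‖x t i ω - mean (fun k => x t k ω)‖) P := by
  have hbound : Integrable (fun ω => consensusBound (Gam η n) (theta η n B) α (∑ j, ‖x 0 j ω‖)
      (fun s => ∑ j, ‖g s j ω‖) t) P :=
    integrable_consensusBound (integrable_finsetSum _ fun j _ => H.integrable_norm_init j)
      (fun s => integrable_finsetSum _ fun j _ => (H.sampling s j).integrable.norm) t
  refine hbound.mono' (H.measurable_norm_state_sub_mean t i).aestronglyMeasurable
    (ae_of_all _ fun ω => ?_)
  rw [norm_norm]
  exact H.norm_state_sub_mean_le t i ω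

lemma integral_norm_state_sub_mean_le (H : IsMirrorDescent P ℱ X ψ α η B G W L ν h x g) (t : ℕ)
    (i : Fin n) :
    ∫ ω, ‖x t i ω - mean (fun k => x t k ω)‖ ∂P ≤ consensusBound (Gam η n) (theta η n B) α
      (n * ∫ ω, (⨆ k, ‖x 0 k ω‖) ∂P) (fun _ => n * (L + ν)) t := by
  have hinit : Integrable (fun ω => ∑ j, ‖x 0 j ω‖) P :=
    integrable_finsetSum _ fun j _ => H.integrable_norm_init j
  have hgrad (s : ℕ) : Integrable (fun ω => ∑ j, ‖g s j ω‖) P :=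
    integrable_finsetSum _ fun j _ => (H.sampling s j).integrable.norm
  refine (integral_mono (H.integrable_norm_state_sub_mean t i)
    (integrable_consensusBound hinit hgrad t) (H.norm_state_sub_mean_le t i)).trans ?_
  rw [integral_consensusBound hinit hgrad]
  refine consensusBound_mono (Gam_pos H.η_lt_one).le (theta_pos H.η_lt_one).le H.nonneg ?_
    (fun s => ?_) t
  · rw [integral_finsetSum _ fun j _ => H.integrable_norm_init j]
    refine (Finset.sum_le_card_nsmul _ _ _ fun j _ => H.integral_norm_init_le j).trans_eq ?_
    rw [Finset.card_univ, Fintype.card_fin, nsmul_eq_mul]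
  · rw [integral_finsetSum _ fun j _ => (H.sampling s j).integrable.norm]
    refine (Finset.sum_le_card_nsmul _ _ _ fun j _ =>
      (H.sampling s j).integral_norm_le (ℱ.le s) H.ν_nonneg).trans_eq ?_
    rw [Finset.card_univ, Fintype.card_fin, nsmul_eq_mul]

lemma sum_integral_consensusCost_le (H : IsMirrorDescent P ℱ X ψ α η B G W L ν h x g) {m : ℕ}
    (hm : 0 < m) {V : ℕ → Matrix (Fin m) (Fin n) ℝ} (hV : ∀ t k j, 0 ≤ V t k j)
    (hVsum : ∀ t k, ∑ j, V t k j = 1) (i : Fin n) (T : ℕ) :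
    ∑ t ∈ Finset.range T, α t * ∫ ω, consensusCost (W t) (V t)
        (fun k => ‖x t k ω - mean (fun a => x t a ω)‖) i ∂P ≤
      4 * (Gam η n * (n * ∫ ω, (⨆ k, ‖x 0 k ω‖) ∂P) * (α 0 / (1 - theta η n B)) +
        Gam η n * (n * (L + ν)) * ((∑ t ∈ Finset.range T, α t ^ 2) / (1 - theta η n B))) := by
  have hsup : 0 ≤ ∫ ω, (⨆ k, ‖x 0 k ω‖) ∂P :=
    integral_nonneg fun ω => Real.iSup_nonneg fun k => norm_nonneg _
  have hLν : 0 ≤ L + ν := add_nonneg (H.sampling 0 i).bound_nonneg H.ν_nonneg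
  refine le_trans (Finset.sum_le_sum fun t _ => mul_le_mul_of_nonneg_left
    (integral_consensusCost_le hm (H.isMixing.weight_nonneg H.η_pos t) (H.isMixing.row_sum t)
      (hV t) (hVsum t) (H.integrable_norm_state_sub_mean t)
      (H.integral_norm_state_sub_mean_le t) i) (H.nonneg t)) ?_
  simp only [mul_left_comm _ (4 : ℝ), ← Finset.mul_sum]
  refine mul_le_mul_of_nonneg_left (sum_mul_consensusBound_le H.antitone H.nonneg
    (Gam_pos H.η_lt_one).le (theta_pos H.η_lt_one).le
    (theta_lt_one H.η_pos H.η_lt_one i.pos H.isMixing.one_le) (by positivity) (by positivity) T)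
    zero_le_four

end Consensus

section Regret

variable [CompleteSpace E]

lemma exists_sampling_error_bound (H : IsMirrorDescent P ℱ X ψ α η B G W L ν h x g) (k : Fin n)
    (T : ℕ) :
    ∃ Ψ : Ω → ℝ, Integrable Ψ P ∧
      (∀ ω, ∀ z ∈ X, ∑ t ∈ Finset.range T, (1 / 2 * ‖α t • g t k ω‖ ^ 2 +
        (α t • noise P (ℱ t) (g t k) ω) (z - mix (W t) (fun a => x t a ω) k)) ≤ Ψ ω) ∧
      ∫ ω, Ψ ω ∂P ≤ bregmanDiamSq X ψ +
        (1 / 2 * (L + ν) ^ 2 + 1 / 2 * ν ^ 2) * ∑ t ∈ Finset.range T, α t ^ 2 := by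
  have hcentred (t : ℕ) : P[fun ω => α t • noise P (ℱ t) (g t k) ω | ℱ t] =ᵐ[P] 0 := by
    filter_upwards [condExp_smul (α t) (noise P (ℱ t) (g t k)) (ℱ t),
      condExp_noise (ℱ.le t) (H.sampling t k).integrable] with ω hsmul hzero
    exact hsmul.trans (by rw [Pi.smul_apply, hzero, Pi.zero_apply, smul_zero])
  obtain ⟨Φ, hΦ, hle, hint⟩ := exists_integrable_sum_apply_sub_le
    (e := fun t ω => α t • noise P (ℱ t) (g t k) ω) ℱ H.isCompact H.isRegularizer
    (fun t => ((H.measurable_subgradient t k).sub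
      (stronglyMeasurable_condExp.mono (ℱ.mono t.le_succ))).const_smul (α t))
    (fun t => (H.sampling t k).memLp_noise.const_smul (α t))
    hcentred (fun t => (H.measurable_mix_state t k).stronglyMeasurable)
    (fun t ω => H.mix_state_mem t k ω) T
  have hsq (t : ℕ) : Integrable (fun ω => 1 / 2 * ‖α t • g t k ω‖ ^ 2) P :=
    (((H.sampling t k).memLp.const_smul (α t)).integrable_norm_pow two_ne_zero).const_mul _
  have hsum := integrable_finsetSum (Finset.range T) fun t _ => hsq t
  refine ⟨fun ω => Φ ω + ∑ t ∈ Finset.range T, 1 / 2 * ‖α t • g t k ω‖ ^ 2, hΦ.add hsum,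
    fun ω z hz => ?_, ?_⟩
  · rw [Finset.sum_add_distrib, add_comm]
    exact add_le_add_left (hle ω z hz) _
  · rw [integral_add hΦ hsum, integral_finsetSum _ fun t _ => hsq t]
    simp only [norm_smul, mul_pow, Real.norm_eq_abs, sq_abs, integral_const_mul] at hint ⊢
    refine (add_le_add_left hint _).trans ?_
    rw [add_assoc, ← Finset.sum_add_distrib, Finset.mul_sum]
    refine add_le_add_right (Finset.sum_le_sum fun t _ => ?_) _
    have hg := (H.sampling t k).integral_norm_sq_le (ℱ.le t) H.ν_nonneg
    have he := (H.sampling t k).integral_noise_sq_le (ℱ.le t)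
    nlinarith [sq_nonneg (α t)]

theorem exists_avgRegret_bound (H : IsMirrorDescent P ℱ X ψ α η B G W L ν h x g) (hn : 0 < n)
    (T : ℕ) :
    ∃ Ψ : Ω → ℝ, Integrable Ψ P ∧
      (∀ᵐ ω ∂P, ∀ z ∈ X, ∑ t ∈ Finset.range T,
        α t * avgRegret (fun k => h t k ω) (mix (W t) fun a => x t a ω) z ≤ Ψ ω) ∧
      ∫ ω, Ψ ω ∂P ≤ 2 * bregmanDiamSq X ψ +
        (1 / 2 * (L + ν) ^ 2 + 1 / 2 * ν ^ 2) * ∑ t ∈ Finset.range T, α t ^ 2 := by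
  have hn' : (0 : ℝ) < n := by exact_mod_cast hn
  choose Ψ hΨ hle hint using fun k => H.exists_sampling_error_bound k T
  have hsum : Integrable (fun ω => (1 / (n : ℝ)) * ∑ k, Ψ k ω) P :=
    (integrable_finsetSum _ fun k _ => hΨ k).const_mul _
  refine ⟨fun ω => bregmanDiamSq X ψ + (1 / (n : ℝ)) * ∑ k, Ψ k ω,
    (integrable_const _).add hsum, ?_, ?_⟩
  · filter_upwards [ae_all_iff.2 fun t => ae_all_iff.2 fun k =>
      (H.sampling t k).ae_isSubgradientOn] with ω hω z hz
    exact H.sum_avgRegret_le hn hω hz fun k => hle k ω z hz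
  · rw [integral_add (integrable_const _) hsum, integral_const, probReal_univ, one_smul,
      integral_const_mul, integral_finsetSum _ fun k _ => hΨ k, two_mul, add_assoc]
    refine add_le_add_right ?_ _
    rw [one_div, inv_mul_le_iff₀ hn']
    refine (Finset.sum_le_card_nsmul _ _ _ fun k _ => hint k).trans_eq ?_
    rw [Finset.card_univ, Fintype.card_fin, nsmul_eq_mul]

end Regret

variable [CompleteSpace E]

theorem exists_avgRegret_add_consensusCost_bound
    (H : IsMirrorDescent P ℱ X ψ α η B G W L ν h x g) {m : ℕ} (hm : 0 < m)
    {V : ℕ → Matrix (Fin m) (Fin n) ℝ} (hV : ∀ t k j, 0 ≤ V t k j)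
    (hVsum : ∀ t k, ∑ j, V t k j = 1) (i : Fin n) (T : ℕ) :
    ∃ Z : Ω → ℝ, Integrable Z P ∧
      (∀ᵐ ω ∂P, ∀ z ∈ X, ∑ t ∈ Finset.range T,
        α t * (avgRegret (fun k => h t k ω) (mix (W t) fun a => x t a ω) z +
          L * consensusCost (W t) (V t) (fun k => ‖x t k ω - mean (fun a => x t a ω)‖) i) ≤ Z ω) ∧
      ∫ ω, Z ω ∂P ≤
        constM₁ L η n B (∫ ω, (⨆ k, ‖x 0 k ω‖) ∂P) (α 0) (bregmanDiamSq X ψ) +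
          constM₂ L ν η n B * ∑ t ∈ Finset.range T, α t ^ 2 := by
  have hL : 0 ≤ L := (H.sampling 0 i).bound_nonneg
  obtain ⟨Ψ, hΨ, hle, hint⟩ := H.exists_avgRegret_bound i.pos T
  have hcost (t : ℕ) : Integrable (fun ω => α t * consensusCost (W t) (V t)
      (fun k => ‖x t k ω - mean (fun a => x t a ω)‖) i) P :=
    (integrable_consensusCost _ _ (H.integrable_norm_state_sub_mean t) i).const_mul _
  have hsum := (integrable_finsetSum (Finset.range T) fun t _ => hcost t).const_mul L
  refine ⟨fun ω => Ψ ω + L * ∑ t ∈ Finset.range T, α t * consensusCost (W t) (V t)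
    (fun k => ‖x t k ω - mean (fun a => x t a ω)‖) i, hΨ.add hsum, ?_, ?_⟩
  · filter_upwards [hle] with ω hω z hz
    simp only [mul_add, mul_left_comm _ L, Finset.sum_add_distrib, ← Finset.mul_sum]
    exact add_le_add_left (hω z hz) _
  · rw [integral_add hΨ hsum, integral_const_mul, integral_finsetSum _ fun t _ => hcost t]
    simp only [integral_const_mul]
    exact (add_le_add hint (mul_le_mul_of_nonneg_left
      (H.sum_integral_consensusCost_le hm hV hVsum i T) hL)).trans
      (regret_add_consensus_bound_le hL H.ν_nonneg (Finset.sum_nonneg fun t _ => sq_nonneg (α t)))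

end IsMirrorDescent

end OneNetworkExpectation

section LipschitzCosts

variable {E F : Type*} [NormedAddCommGroup E] [NormedAddCommGroup F] {X : Set E} {Y : Set F}
  {L : ℝ}

lemma LipOn.swap {h : E → F → ℝ} (hh : LipOn X Y L h) : LipOn Y X L (fun y x => h x y) :=
  fun y hy y' hy' x hx x' hx' => by
    rw [add_comm ‖y - y'‖]
    exact hh x hx x' hx' y hy y' hy'

lemma LipOn.neg {h : E → F → ℝ} (hh : LipOn X Y L h) : LipOn X Y L (fun x y => -h x y) :=
  fun x hx x' hx' y hy y' hy' => by
    rw [neg_sub_neg, norm_sub_rev x, norm_sub_rev y]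
    exact hh x' hx' x hx y' hy' y hy

lemma LipOn.sub_le_left {h : E → F → ℝ} (hh : LipOn X Y L h) {x x' : E} {y : F} (hx : x ∈ X)
    (hx' : x' ∈ X) (hy : y ∈ Y) : h x y - h x' y ≤ L * ‖x - x'‖ := by
  simpa only [sub_self, norm_zero, add_zero] using (le_abs_self _).trans (hh x hx x' hx' y hy y hy)

lemma LipOn.sub_le_right {h : E → F → ℝ} (hh : LipOn X Y L h) {x : E} {y y' : F} (hx : x ∈ X)
    (hy : y ∈ Y) (hy' : y' ∈ Y) : h x y - h x y' ≤ L * ‖y - y'‖ :=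
  hh.swap.sub_le_left hy hy' hx

lemma continuousOn_of_sub_le {f : E → ℝ} (hL : 0 ≤ L)
    (hf : ∀ x ∈ X, ∀ x' ∈ X, f x - f x' ≤ L * ‖x - x'‖) : ContinuousOn f X := by
  refine (LipschitzOnWith.of_le_add_mul L.toNNReal fun x hx x' hx' => ?_).continuousOn
  rw [Real.coe_toNNReal L hL, dist_eq_norm, ← sub_le_iff_le_add']
  exact hf x hx x' hx'

lemma LipOn.bddAbove_image (hL : 0 ≤ L) {h : E → F → ℝ} (hh : LipOn X Y L h) (hY : IsCompact Y)
    {x : E} (hx : x ∈ X) : BddAbove (h x '' Y) :=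
  hY.bddAbove_image (continuousOn_of_sub_le hL fun _ hy _ hy' => hh.sub_le_right hx hy hy')

lemma LipOn.continuousOn_sSup (hL : 0 ≤ L) {h : E → F → ℝ} (hh : LipOn X Y L h)
    (hY : IsCompact Y) (hYne : Y.Nonempty) : ContinuousOn (fun x => sSup (h x '' Y)) X := by
  refine continuousOn_of_sub_le hL fun x hx x' hx' => ?_
  rw [sub_le_iff_le_add]
  refine csSup_le (hYne.image _) ?_
  rintro _ ⟨y, hy, rfl⟩
  rw [← sub_le_iff_le_add]
  have hsup : h x' y ≤ sSup (h x' '' Y) :=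
    le_csSup (hh.bddAbove_image hL hY hx') (mem_image_of_mem _ hy)
  exact (sub_le_sub_left hsup _).trans (hh.sub_le_left hx hx' hy)

variable {n : ℕ} {f : Fin n → E → F → ℝ}

lemma LipOn.avgCost (hn : 0 < n) (hf : ∀ k, LipOn X Y L (f k)) : LipOn X Y L (avgCost f) := by
  intro x hx x' hx' y hy y' hy'
  have hn' : (0 : ℝ) < n := by exact_mod_cast hn
  unfold DSMD.avgCost
  rw [← mul_sub, ← Finset.sum_sub_distrib, abs_mul, abs_of_pos (by positivity), one_div,
    inv_mul_le_iff₀ hn']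
  calc |∑ k, (f k x y - f k x' y')| ≤ ∑ k, |f k x y - f k x' y'| :=
        Finset.abs_sum_le_sum_abs _ _
    _ ≤ ∑ _k : Fin n, L * (‖x - x'‖ + ‖y - y'‖) :=
        Finset.sum_le_sum fun k _ => hf k x hx x' hx' y hy y' hy'
    _ = n * (L * (‖x - x'‖ + ‖y - y'‖)) := by
        rw [Finset.sum_const, Finset.card_univ, Fintype.card_fin, nsmul_eq_mul]

lemma avgCost_sub_le (hf : ∀ k, LipOn X Y L (f k)) {a z : E} {b : F} {v : Fin n → E}
    {u : Fin n → F} (ha : a ∈ X) (hz : z ∈ X) (hb : b ∈ Y) (hv : ∀ k, v k ∈ X)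
    (hu : ∀ k, u k ∈ Y) :
    avgCost f a b - avgCost f z b ≤ avgRegret (fun k x => f k x (u k)) v z +
      L * ((1 / (n : ℝ)) * ∑ k, ‖v k - a‖ + 2 * ((1 / (n : ℝ)) * ∑ k, ‖u k - b‖)) := by
  have agentwise (k : Fin n) : f k a b - f k z b ≤ (f k (v k) (u k) - f k z (u k)) +
      L * (‖v k - a‖ + 2 * ‖u k - b‖) := by
    have hmove := (le_abs_self _).trans (hf k a ha (v k) (hv k) b hb (u k) (hu k))
    have hback := (hf k).sub_le_right hz (hu k) hb
    rw [norm_sub_rev a, norm_sub_rev b] at hmove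
    linarith
  calc avgCost f a b - avgCost f z b = (1 / (n : ℝ)) * ∑ k, (f k a b - f k z b) := by
        rw [avgCost, avgCost, ← mul_sub, Finset.sum_sub_distrib]
    _ ≤ (1 / (n : ℝ)) * ∑ k, ((f k (v k) (u k) - f k z (u k)) +
          L * (‖v k - a‖ + 2 * ‖u k - b‖)) := by
        gcongr with k
        exact agentwise k
    _ = _ := by
        simp only [avgRegret, Finset.sum_add_distrib, ← Finset.mul_sum]
        ring

lemma avgCost_sub_le_avgRegret_mix [NormedSpace ℝ E] [NormedSpace ℝ F] {p q : ℕ} (hL : 0 ≤ L)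
    (hf : ∀ k, LipOn X Y L (f k)) (hX : Convex ℝ X) (hY : Convex ℝ Y)
    {w : Matrix (Fin n) (Fin p) ℝ} (hw : ∀ k a, 0 ≤ w k a) (hwsum : ∀ k, ∑ a, w k a = 1)
    {v : Matrix (Fin n) (Fin q) ℝ} (hv : ∀ k b, 0 ≤ v k b) (hvsum : ∀ k, ∑ b, v k b = 1)
    {x : Fin p → E} {y : Fin q → F} (hx : ∀ a, x a ∈ X) (hy : ∀ b, y b ∈ Y) {c z : E} {e : F}
    (hc : c ∈ X) (hz : z ∈ X) (he : e ∈ Y) :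
    avgCost f c e - avgCost f z e ≤ avgRegret (fun k a => f k a (mix v y k)) (mix w x) z +
      L * (avgMix w (fun a => ‖x a - c‖) + 2 * avgMix v (fun b => ‖y b - e‖)) := by
  refine (avgCost_sub_le hf hc hz he (fun k => mix_mem hX (hw k) (hwsum k) hx)
    fun k => mix_mem hY (hv k) (hvsum k) hy).trans ?_
  gcongr
  · exact avg_norm_mix_sub_le_avgMix hw hwsum x c
  · exact avg_norm_mix_sub_le_avgMix hv hvsum y e

end LipschitzCosts

section TimeAverages

variable {E F : Type*} [NormedAddCommGroup E] [NormedSpace ℝ E] [NormedAddCommGroup F]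
  [NormedSpace ℝ F] {X : Set E} {Y : Set F} {α : ℕ → ℝ} {x : ℕ → E} {t : ℕ}

lemma ConvexConcaveOn.avgCost {n : ℕ} {f : Fin n → E → F → ℝ} (hX : Convex ℝ X)
    (hY : Convex ℝ Y) (hf : ∀ k, ConvexConcaveOn X Y (f k)) : ConvexConcaveOn X Y (avgCost f) := by
  refine ⟨fun y hy => ⟨hX, fun x hx x' hx' a b ha hb hab => ?_⟩,
    fun x hx => ⟨hY, fun y hy y' hy' a b ha hb hab => ?_⟩⟩
  · simp only [DSMD.avgCost, smul_eq_mul]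
    calc _ ≤ (1 / (n : ℝ)) * ∑ k, (a * f k x y + b * f k x' y) := by
          gcongr with k
          exact ((hf k).1 y hy).2 hx hx' ha hb hab
      _ = _ := by rw [Finset.sum_add_distrib, ← Finset.mul_sum, ← Finset.mul_sum]; ring
  · simp only [DSMD.avgCost, smul_eq_mul]
    calc _ = (1 / (n : ℝ)) * ∑ k, (a * f k x y + b * f k x y') := by
          rw [Finset.sum_add_distrib, ← Finset.mul_sum, ← Finset.mul_sum]; ring
      _ ≤ _ := by
          gcongr with k
          exact ((hf k).2 x hx).2 hy hy' ha hb hab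

lemma timeAvg_mem (hX : Convex ℝ X) (hα : ∀ s, 0 ≤ α s) (hpos : 0 < ∑ s ∈ Finset.range t, α s)
    (hx : ∀ s, x s ∈ X) : timeAvg α x t ∈ X :=
  hX.centerMass_mem (fun s _ => hα s) hpos fun s _ => hx s

lemma mul_timeAvg_le_of_convexOn {f : E → ℝ} (hf : ConvexOn ℝ X f) (hα : ∀ s, 0 ≤ α s)
    (hpos : 0 < ∑ s ∈ Finset.range t, α s) (hx : ∀ s, x s ∈ X) :
    (∑ s ∈ Finset.range t, α s) * f (timeAvg α x t) ≤ ∑ s ∈ Finset.range t, α s * f (x s) := by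
  have jensen : f (timeAvg α x t) ≤
      (∑ s ∈ Finset.range t, α s)⁻¹ • ∑ s ∈ Finset.range t, α s • f (x s) :=
    hf.map_centerMass_le (fun s _ => hα s) hpos fun s _ => hx s
  rwa [smul_eq_mul, ← div_eq_inv_mul, le_div_iff₀' hpos] at jensen

lemma ConvexConcaveOn.mul_timeAvg_sub_le {h : E → F → ℝ} (hh : ConvexConcaveOn X Y h)
    {y : ℕ → F} (hα : ∀ s, 0 ≤ α s) (hpos : 0 < ∑ s ∈ Finset.range t, α s) (hx : ∀ s, x s ∈ X)
    (hy : ∀ s, y s ∈ Y) {a : E} {b : F} (ha : a ∈ X) (hb : b ∈ Y) :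
    (∑ s ∈ Finset.range t, α s) * (h (timeAvg α x t) b - h a (timeAvg α y t)) ≤
      ∑ s ∈ Finset.range t, α s * (h (x s) b - h a (y s)) := by
  have hleft := mul_timeAvg_le_of_convexOn (hh.1 b hb) hα hpos hx
  have hright := mul_timeAvg_le_of_convexOn (hh.2 a ha).neg hα hpos hy
  simp only [Pi.neg_apply, mul_neg, Finset.sum_neg_distrib] at hright
  simp only [mul_sub, Finset.sum_sub_distrib]
  linarith

end TimeAverages

section TwoNetworks

variable {Ω E₁ E₂ : Type*} [mΩ : MeasurableSpace Ω]
  [NormedAddCommGroup E₁] [NormedSpace ℝ E₁] [NormedAddCommGroup E₂] [NormedSpace ℝ E₂]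
  {P : Measure Ω} {n₁ n₂ d : ℕ} {Γ : Game P E₁ E₂ n₁ n₂ d} {L : ℝ}

namespace Game

lemma U_eq_neg_avgCost (Γ : Game P E₁ E₂ n₁ n₂ d) {x₁ : E₁} {x₂ : E₂} (h₁ : x₁ ∈ Γ.X₁)
    (h₂ : x₂ ∈ Γ.X₂) : Γ.U x₁ x₂ = -avgCost Γ.f₂ x₁ x₂ := Γ.zero_sum x₁ h₁ x₂ h₂

lemma LipschitzAssumption.lipOn_U (h : Γ.LipschitzAssumption L) (hn : 0 < n₁) :
    LipOn Γ.X₁ Γ.X₂ L Γ.U := LipOn.avgCost hn h.2.1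

lemma gap_eq (Γ : Game P E₁ E₂ n₁ n₂ d) (y₁ : E₁) (y₂ : E₂) :
    Γ.gap y₁ y₂ = sSup (Γ.U y₁ '' Γ.X₂) + sSup ((fun x₁ => -Γ.U x₁ y₂) '' Γ.X₁) := by
  rw [gap, sub_eq_add_neg, ← Real.sSup_neg, ← Set.image_neg_eq_neg, Set.image_image]

lemma gap_le (Γ : Game P E₁ E₂ n₁ n₂ d) {y₁ : E₁} {y₂ : E₂} {c : ℝ}
    (h : ∀ x₁ ∈ Γ.X₁, ∀ x₂ ∈ Γ.X₂, Γ.U y₁ x₂ - Γ.U x₁ y₂ ≤ c) : Γ.gap y₁ y₂ ≤ c := by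
  rw [gap, sub_le_iff_le_add]
  refine csSup_le (Γ.nonempty₂.image _) ?_
  rintro _ ⟨x₂, hx₂, rfl⟩
  rw [← sub_le_iff_le_add']
  refine le_csInf (Γ.nonempty₁.image _) ?_
  rintro _ ⟨x₁, hx₁, rfl⟩
  linarith [h x₁ hx₁ x₂ hx₂]

lemma integrable_gap [IsFiniteMeasure P] [MeasurableSpace E₁] [BorelSpace E₁]
    [MeasurableSpace E₂] [BorelSpace E₂] (hL : 0 ≤ L) (hU : LipOn Γ.X₁ Γ.X₂ L Γ.U)
    {y₁ : Ω → E₁} {y₂ : Ω → E₂} (hm₁ : Measurable y₁) (hm₂ : Measurable y₂)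
    (h₁ : ∀ ω, y₁ ω ∈ Γ.X₁) (h₂ : ∀ ω, y₂ ω ∈ Γ.X₂) :
    Integrable (fun ω => Γ.gap (y₁ ω) (y₂ ω)) P := by
  have hmax := hU.continuousOn_sSup hL Γ.compact₂ Γ.nonempty₂
  have hmin := hU.neg.swap.continuousOn_sSup hL Γ.compact₁ Γ.nonempty₁
  obtain ⟨C₁, hC₁⟩ := Γ.compact₁.exists_bound_of_continuousOn hmax
  obtain ⟨C₂, hC₂⟩ := Γ.compact₂.exists_bound_of_continuousOn hmin
  simp only [gap_eq]
  exact (Integrable.of_bound (measurable_comp_of_continuousOn hmax hm₁ h₁).aestronglyMeasurable C₁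
    (ae_of_all _ fun ω => hC₁ _ (h₁ ω))).add
    (Integrable.of_bound (measurable_comp_of_continuousOn hmin hm₂ h₂).aestronglyMeasurable C₂
    (ae_of_all _ fun ω => hC₂ _ (h₂ ω)))

variable {η : ℝ} {B₁ B₂ : ℕ} (N : Network n₁ n₂ η B₁ B₂)

lemma U_sub_U_le (h : Γ.LipschitzAssumption L) {x₁ : Fin n₁ → E₁} {x₂ : Fin n₂ → E₂}
    (hx₁ : ∀ k, x₁ k ∈ Γ.X₁) (hx₂ : ∀ k, x₂ k ∈ Γ.X₂) {z₁ : E₁} {z₂ : E₂} (hz₁ : z₁ ∈ Γ.X₁)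
    (hz₂ : z₂ ∈ Γ.X₂) (s : ℕ) (i : Fin n₁) (j : Fin n₂) :
    Γ.U (x₁ i) z₂ - Γ.U z₁ (x₂ j) ≤
      (avgRegret (fun k y => Γ.f₁ k y (mix (N.W₁₂ s) x₂ k)) (mix (N.W₁ s) x₁) z₁ +
        L * consensusCost (N.W₁ s) (N.W₂₁ s) (fun k => ‖x₁ k - mean x₁‖) i) +
      (avgRegret (fun k y => Γ.f₂ k (mix (N.W₂₁ s) x₁ k) y) (mix (N.W₂ s) x₂) z₂ +
        L * consensusCost (N.W₂ s) (N.W₁₂ s) (fun k => ‖x₂ k - mean x₂‖) j) := by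
  have hm₁ : mean x₁ ∈ Γ.X₁ := mean_mem Γ.convex₁ i.pos hx₁
  have hm₂ : mean x₂ ∈ Γ.X₂ := mean_mem Γ.convex₂ j.pos hx₂
  have move₁ : Γ.U (x₁ i) z₂ - Γ.U (mean x₁) z₂ ≤ L * ‖x₁ i - mean x₁‖ :=
    (h.lipOn_U i.pos).sub_le_left (hx₁ i) hm₁ hz₂
  have move₂ : Γ.U z₁ (mean x₂) - Γ.U z₁ (x₂ j) ≤ L * ‖x₂ j - mean x₂‖ := by
    rw [norm_sub_rev]
    exact (h.lipOn_U i.pos).sub_le_right hz₁ hm₂ (hx₂ j)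
  have regret₁ : Γ.U (mean x₁) (mean x₂) - Γ.U z₁ (mean x₂) ≤ _ :=
    avgCost_sub_le_avgRegret_mix h.1.le h.2.1 Γ.convex₁ Γ.convex₂
      (N.mixing₁.weight_nonneg N.η_pos s) (N.mixing₁.row_sum s) (N.nonneg₁₂ s) (N.row_sum₁₂ s)
      hx₁ hx₂ hm₁ hz₁ hm₂
  have regret₂ : avgCost Γ.f₂ (mean x₁) (mean x₂) - avgCost Γ.f₂ (mean x₁) z₂ ≤ _ :=
    avgCost_sub_le_avgRegret_mix (f := fun k y x => Γ.f₂ k x y) h.1.le (fun k => (h.2.2 k).swap)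
      Γ.convex₂ Γ.convex₁ (N.mixing₂.weight_nonneg N.η_pos s) (N.mixing₂.row_sum s)
      (N.nonneg₂₁ s) (N.row_sum₂₁ s) hx₂ hx₁ hm₂ hz₂ hm₁
  have hmean := Γ.U_eq_neg_avgCost hm₁ hm₂
  have hdev := Γ.U_eq_neg_avgCost hm₁ hz₂
  simp only [consensusCost]
  linarith

lemma mul_gap_timeAvg_le (h : Γ.LipschitzAssumption L) (hU : ConvexConcaveOn Γ.X₁ Γ.X₂ Γ.U)
    {α : ℕ → ℝ} {t : ℕ} (hα : ∀ s, 0 ≤ α s) (hpos : 0 < ∑ s ∈ Finset.range t, α s)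
    {x₁ : ℕ → Fin n₁ → E₁} {x₂ : ℕ → Fin n₂ → E₂} (hx₁ : ∀ s k, x₁ s k ∈ Γ.X₁)
    (hx₂ : ∀ s k, x₂ s k ∈ Γ.X₂) {i : Fin n₁} {j : Fin n₂} {c₁ c₂ : ℝ}
    (hc₁ : ∀ z ∈ Γ.X₁, ∑ s ∈ Finset.range t, α s *
      (avgRegret (fun k y => Γ.f₁ k y (mix (N.W₁₂ s) (x₂ s) k)) (mix (N.W₁ s) (x₁ s)) z +
        L * consensusCost (N.W₁ s) (N.W₂₁ s) (fun k => ‖x₁ s k - mean (x₁ s)‖) i) ≤ c₁)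
    (hc₂ : ∀ z ∈ Γ.X₂, ∑ s ∈ Finset.range t, α s *
      (avgRegret (fun k y => Γ.f₂ k (mix (N.W₂₁ s) (x₁ s) k) y) (mix (N.W₂ s) (x₂ s)) z +
        L * consensusCost (N.W₂ s) (N.W₁₂ s) (fun k => ‖x₂ s k - mean (x₂ s)‖) j) ≤ c₂) :
    (∑ s ∈ Finset.range t, α s) *
      Γ.gap (timeAvg α (fun s => x₁ s i) t) (timeAvg α (fun s => x₂ s j) t) ≤ c₁ + c₂ := by
  rw [← le_div_iff₀' hpos]
  refine Γ.gap_le fun z₁ hz₁ z₂ hz₂ => ?_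
  rw [le_div_iff₀' hpos]
  refine (hU.mul_timeAvg_sub_le hα hpos (fun s => hx₁ s i) (fun s => hx₂ s j) hz₁ hz₂).trans ?_
  refine (Finset.sum_le_sum fun s _ => mul_le_mul_of_nonneg_left
    (U_sub_U_le N h (hx₁ s) (hx₂ s) hz₁ hz₂ s i j) (hα s)).trans ?_
  simp only [mul_add _ (_ + _) (_ + _)]
  rw [Finset.sum_add_distrib]
  exact add_le_add (hc₁ z₁ hz₁) (hc₂ z₂ hz₂)

end Game

end TwoNetworks

namespace IsMirrorDescent

variable {Ω E : Type*} [mΩ : MeasurableSpace Ω] [NormedAddCommGroup E] [NormedSpace ℝ E]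
  [MeasurableSpace E] [BorelSpace E] [SecondCountableTopology E] {n : ℕ} {P : Measure Ω}
  {ℱ : Filtration ℕ mΩ} {X : Set E} {ψ : E → ℝ} {α : ℕ → ℝ} {η : ℝ} {B : ℕ}
  {G : ℕ → Digraph (Fin n)} {W : ℕ → Matrix (Fin n) (Fin n) ℝ} {L ν : ℝ}
  {h : ℕ → Fin n → Ω → E → ℝ} {x : ℕ → Fin n → Ω → E} {g : ℕ → Fin n → Ω → StrongDual ℝ E}

lemma measurable_timeAvg_state (H : IsMirrorDescent P ℱ X ψ α η B G W L ν h x g) (t : ℕ)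
    (i : Fin n) : Measurable fun ω => timeAvg α (fun s => x s i ω) t :=
  (Finset.measurable_fun_sum _ fun s _ =>
    ((H.measurable_state s i).mono (ℱ.le s) le_rfl).const_smul _).const_smul _

end IsMirrorDescent

section History

variable {Ω E₁ E₂ : Type*} [MeasurableSpace E₁] [MeasurableSpace E₂] {n₁ n₂ d : ℕ}
  {x₁ : Fin n₁ → Ω → E₁} {x₂ : Fin n₂ → Ω → E₂} {ξ : ℕ → Fin n₁ ⊕ Fin n₂ → Ω → Fin d → ℝ}

lemma history_mono : Monotone (history x₁ x₂ ξ) := fun _ _ hst =>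
  sup_le_sup le_rfl (iSup_mono fun _ => iSup_mono' fun h => ⟨h.trans_le hst, le_rfl⟩)

lemma history_le [mΩ : MeasurableSpace Ω] (h₁ : ∀ i, Measurable (x₁ i))
    (h₂ : ∀ j, Measurable (x₂ j)) (hξ : ∀ t k, Measurable (ξ t k)) (t : ℕ) :
    history x₁ x₂ ξ t ≤ mΩ :=
  sup_le (sup_le (iSup_le fun i => (h₁ i).comap_le) (iSup_le fun j => (h₂ j).comap_le))
    (iSup_le fun s => iSup_le fun _ => iSup_le fun k => (hξ s k).comap_le)

lemma measurable_history_left (t : ℕ) (i : Fin n₁) : Measurable[history x₁ x₂ ξ t] (x₁ i) :=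
  Measurable.of_comap_le (le_sup_of_le_left (le_sup_of_le_left (le_iSup_of_le i le_rfl)))

lemma measurable_history_right (t : ℕ) (j : Fin n₂) : Measurable[history x₁ x₂ ξ t] (x₂ j) :=
  Measurable.of_comap_le (le_sup_of_le_left (le_sup_of_le_right (le_iSup_of_le j le_rfl)))

end History

namespace Run

variable {Ω E₁ E₂ : Type*} [mΩ : MeasurableSpace Ω]
  [NormedAddCommGroup E₁] [NormedSpace ℝ E₁] [MeasurableSpace E₁]
  [NormedAddCommGroup E₂] [NormedSpace ℝ E₂] [MeasurableSpace E₂]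
  {P : Measure Ω} {n₁ n₂ d : ℕ} {Γ : Game P E₁ E₂ n₁ n₂ d} {η : ℝ} {B₁ B₂ : ℕ}
  {N : Network n₁ n₂ η B₁ B₂} {ψ₁ : E₁ → ℝ} {ψ₂ : E₂ → ℝ} {α : ℕ → ℝ} {L ν₁ ν₂ : ℝ}

/-- The filtration of the histories of a run. -/
def filtration (R : Run Γ N ψ₁ ψ₂ α) : Filtration ℕ mΩ where
  seq := history (R.x₁ 0) (R.x₂ 0) R.ξ
  mono' := history_mono
  le' := history_le R.measurable_init₁ R.measurable_init₂ R.measurable_ξ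

lemma isMirrorDescent₁ (R : Run Γ N ψ₁ ψ₂ α) (hψ : IsRegularizer Γ.X₁ ψ₁)
    (hB : BregmanAssumption Γ.X₁ ψ₁) (hα : Antitone α) (hα0 : ∀ t, 0 ≤ α t)
    (hS : R.SamplingAssumption L ν₁ ν₂) :
    IsMirrorDescent P R.filtration Γ.X₁ ψ₁ α η B₁ N.G₁ N.W₁ L ν₁
      (fun t i ω y => Γ.f₁ i y (mix (N.W₁₂ t) (fun j => R.x₂ t j ω) i)) R.x₁ R.g₁ where
  isCompact := Γ.compact₁
  isRegularizer := hψ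
  convexOn_right := hB.convexOn_right
  isMixing := N.mixing₁
  η_pos := N.η_pos
  η_lt_one := N.η_lt_one
  antitone := hα
  nonneg := hα0
  ν_nonneg := hS.1.le
  measurable_init := measurable_history_left 0
  init_mem := R.init_mem₁
  measurable_subgradient := R.measurable_g₁
  step := R.step₁
  sampling := hS.2.2.1

lemma isMirrorDescent₂ (R : Run Γ N ψ₁ ψ₂ α) (hψ : IsRegularizer Γ.X₂ ψ₂)
    (hB : BregmanAssumption Γ.X₂ ψ₂) (hα : Antitone α) (hα0 : ∀ t, 0 ≤ α t)
    (hS : R.SamplingAssumption L ν₁ ν₂) :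
    IsMirrorDescent P R.filtration Γ.X₂ ψ₂ α η B₂ N.G₂ N.W₂ L ν₂
      (fun t j ω y => Γ.f₂ j (mix (N.W₂₁ t) (fun i => R.x₁ t i ω) j) y) R.x₂ R.g₂ where
  isCompact := Γ.compact₂
  isRegularizer := hψ
  convexOn_right := hB.convexOn_right
  isMixing := N.mixing₂
  η_pos := N.η_pos
  η_lt_one := N.η_lt_one
  antitone := hα
  nonneg := hα0
  ν_nonneg := hS.2.1.le
  measurable_init := measurable_history_right 0
  init_mem := R.init_mem₂
  measurable_subgradient := R.measurable_g₂
  step := R.step₂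
  sampling := hS.2.2.2

end Run

end DSMD

end

theorem theorem4_general {Ω E₁ E₂ : Type*} [mΩ : MeasurableSpace Ω]
    [NormedAddCommGroup E₁] [NormedSpace ℝ E₁] [CompleteSpace E₁] [SecondCountableTopology E₁]
    [MeasurableSpace E₁] [BorelSpace E₁]
    [NormedAddCommGroup E₂] [NormedSpace ℝ E₂] [CompleteSpace E₂] [SecondCountableTopology E₂]
    [MeasurableSpace E₂] [BorelSpace E₂]
    {P : Measure Ω} [IsProbabilityMeasure P] {n₁ n₂ d : ℕ} {Γ : DSMD.Game P E₁ E₂ n₁ n₂ d}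
    {η : ℝ} {B₁ B₂ : ℕ} (N : DSMD.Network n₁ n₂ η B₁ B₂) {ψ₁ : E₁ → ℝ} {ψ₂ : E₂ → ℝ}
    {α : ℕ → ℝ} (hα_zero : 0 < α 0) {ℱ₁ ℱ₂ : Filtration ℕ mΩ} {L ν₁ ν₂ : ℝ}
    {x₁ : ℕ → Fin n₁ → Ω → E₁} {x₂ : ℕ → Fin n₂ → Ω → E₂}
    {g₁ : ℕ → Fin n₁ → Ω → StrongDual ℝ E₁} {g₂ : ℕ → Fin n₂ → Ω → StrongDual ℝ E₂}
    (hU : DSMD.ConvexConcaveOn Γ.X₁ Γ.X₂ Γ.U) (hLip : Γ.LipschitzAssumption L)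
    (H₁ : DSMD.IsMirrorDescent P ℱ₁ Γ.X₁ ψ₁ α η B₁ N.G₁ N.W₁ L ν₁
      (fun t i ω y => Γ.f₁ i y (DSMD.mix (N.W₁₂ t) (fun j => x₂ t j ω) i)) x₁ g₁)
    (H₂ : DSMD.IsMirrorDescent P ℱ₂ Γ.X₂ ψ₂ α η B₂ N.G₂ N.W₂ L ν₂
      (fun t j ω y => Γ.f₂ j (DSMD.mix (N.W₂₁ t) (fun i => x₁ t i ω) j) y) x₂ g₂)
    (i : Fin n₁) (j : Fin n₂) {t : ℕ} (ht : 1 ≤ t) :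
    Integrable (fun ω => Γ.gap (DSMD.timeAvg α (fun s => x₁ s i ω) t)
      (DSMD.timeAvg α (fun s => x₂ s j ω) t)) P ∧
    ∫ ω, Γ.gap (DSMD.timeAvg α (fun s => x₁ s i ω) t)
      (DSMD.timeAvg α (fun s => x₂ s j ω) t) ∂P ≤
      ((DSMD.constM₁ L η n₁ B₁ (∫ ω, (⨆ k, ‖x₁ 0 k ω‖) ∂P) (α 0)
            (DSMD.bregmanDiamSq Γ.X₁ ψ₁) +
          DSMD.constM₁ L η n₂ B₂ (∫ ω, (⨆ k, ‖x₂ 0 k ω‖) ∂P) (α 0)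
            (DSMD.bregmanDiamSq Γ.X₂ ψ₂)) +
        (DSMD.constM₂ L ν₁ η n₁ B₁ + DSMD.constM₂ L ν₂ η n₂ B₂) *
          ∑ s ∈ Finset.range t, α s ^ 2) /
      ∑ s ∈ Finset.range t, α s := by
  have hpos : 0 < ∑ s ∈ Finset.range t, α s :=
    Finset.sum_pos' (fun s _ => H₁.nonneg s) ⟨0, Finset.mem_range.2 ht, hα_zero⟩
  have hgap := Γ.integrable_gap hLip.1.le (hLip.lipOn_U i.pos)
    (H₁.measurable_timeAvg_state t i) (H₂.measurable_timeAvg_state t j)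
    (fun ω => DSMD.timeAvg_mem Γ.convex₁ H₁.nonneg hpos fun s => H₁.state_mem s i ω)
    (fun ω => DSMD.timeAvg_mem Γ.convex₂ H₂.nonneg hpos fun s => H₂.state_mem s j ω)
  obtain ⟨Z₁, hZ₁, hle₁, hint₁⟩ :=
    H₁.exists_avgRegret_add_consensusCost_bound j.pos N.nonneg₂₁ N.row_sum₂₁ i t
  obtain ⟨Z₂, hZ₂, hle₂, hint₂⟩ :=
    H₂.exists_avgRegret_add_consensusCost_bound i.pos N.nonneg₁₂ N.row_sum₁₂ j t
  have pathwise := integral_mono_ae (hgap.const_mul _) (hZ₁.add hZ₂) <| by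
    filter_upwards [hle₁, hle₂] with ω hω₁ hω₂
    exact DSMD.Game.mul_gap_timeAvg_le N hLip hU H₁.nonneg hpos
      (fun s k => H₁.state_mem s k ω) (fun s k => H₂.state_mem s k ω) hω₁ hω₂
  rw [integral_const_mul, integral_add' hZ₁ hZ₂] at pathwise
  refine ⟨hgap, (le_div_iff₀' hpos).2 ?_⟩
  rw [add_mul]
  linarith

theorem theorem4 {Ω E₁ E₂ : Type*} [MeasurableSpace Ω]
    [NormedAddCommGroup E₁] [NormedSpace ℝ E₁] [FiniteDimensional ℝ E₁]
    [MeasurableSpace E₁] [BorelSpace E₁]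
    [NormedAddCommGroup E₂] [NormedSpace ℝ E₂] [FiniteDimensional ℝ E₂]
    [MeasurableSpace E₂] [BorelSpace E₂]
    (P : Measure Ω) [IsProbabilityMeasure P] {n₁ n₂ d : ℕ}
    (Γ : DSMD.Game P E₁ E₂ n₁ n₂ d)
    {η : ℝ} {B₁ B₂ : ℕ} (N : DSMD.Network n₁ n₂ η B₁ B₂)
    (ψ₁ : E₁ → ℝ) (ψ₂ : E₂ → ℝ)
    (hψ₁ : DSMD.IsRegularizer Γ.X₁ ψ₁) (hψ₂ : DSMD.IsRegularizer Γ.X₂ ψ₂)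
    (α : ℕ → ℝ) (hα_anti : Antitone α) (hα_nonneg : ∀ t, 0 ≤ α t) (hα_zero : 0 < α 0)
    (R : DSMD.Run Γ N ψ₁ ψ₂ α) (L ν₁ ν₂ : ℝ)
    (hcc : Γ.CostsConvexConcave)
    (hLip : Γ.LipschitzAssumption L)
    (hSamp : R.SamplingAssumption L ν₁ ν₂)
    (hBreg₁ : DSMD.BregmanAssumption Γ.X₁ ψ₁) (hBreg₂ : DSMD.BregmanAssumption Γ.X₂ ψ₂)
    (i : Fin n₁) (j : Fin n₂) (t : ℕ) (ht : 1 ≤ t) :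
    Integrable (fun ω => Γ.gap (DSMD.timeAvg α (fun s => R.x₁ s i ω) t)
      (DSMD.timeAvg α (fun s => R.x₂ s j ω) t)) P ∧
    ∫ ω, Γ.gap (DSMD.timeAvg α (fun s => R.x₁ s i ω) t)
      (DSMD.timeAvg α (fun s => R.x₂ s j ω) t) ∂P ≤
      ((DSMD.constM₁ L η n₁ B₁ R.Lam₁ (α 0) (DSMD.bregmanDiamSq Γ.X₁ ψ₁) +
          DSMD.constM₁ L η n₂ B₂ R.Lam₂ (α 0) (DSMD.bregmanDiamSq Γ.X₂ ψ₂)) +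
        (DSMD.constM₂ L ν₁ η n₁ B₁ + DSMD.constM₂ L ν₂ η n₂ B₂) *
          ∑ s ∈ Finset.range t, α s ^ 2) /
      ∑ s ∈ Finset.range t, α s := by
  have := FiniteDimensional.proper ℝ E₁
  have := FiniteDimensional.proper ℝ E₂
  exact theorem4_general N hα_zero
    (DSMD.ConvexConcaveOn.avgCost Γ.convex₁ Γ.convex₂ hcc.1) hLip
    (R.isMirrorDescent₁ hψ₁ hBreg₁ hα_anti hα_nonneg hSamp)
    (R.isMirrorDescent₂ hψ₂ hBreg₂ hα_anti hα_nonneg hSamp) i j ht
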